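/- Let $k$ be a field of characteristic not $2$ and let $\langle A,\Delta\rangle$ be a coalgebra over $k$, i.e. a vector space with a linear map $\Delta:A\to A\otimes A$. Its dual algebra is $A^*$ with $\langle fg,a\rangle=\sum\langle f,a_{(1)}\rangle\langle g,a_{(2)}\rangle$, where $\Delta(a)=\sum a_{(1)}\otimes a_{(2)}$. A subspace $B\subseteq A$ is a subcoalgebra if $\Delta(B)\subseteq B\otimes B$. A coalgebra is called Jordan (Lie) if its dual algebra is a Jordan (Lie) algebra. Assume that $\langle A,\Delta\rangle$ is a Jordan coalgebra and that $A^*$ has a unity. Operators are written on the right. In any algebra $a'$ denotes right multiplication by $a$ and $[a,b]=a'b'-b'a'$. Let $\mathrm{IntDer}(A^*)$ be the span of all $[f,g]$ with $f,g\in A^*$, and let $\mathrm{WIntDer}(A^*)$ be the space of those derivations $d$ of $A^*$ such that for each finite-dimensional subcoalgebra $B$ there is $i\in\mathrm{IntDer}(A^*)$ with $\langle fd,b\rangle=\langle fi,b\rangle$ for all $f\in A^*$, $b\in B$. Let $R(A^*)=(A^*)'\oplus\mathrm{WIntDer}(A^*)$ with $\varepsilon(f'+d)=-f'+d$ and $f\nabla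 g=(fg)'-[f,g]$, and let $L(A^*)=A^*\oplus R(A^*)\oplus\overline{A^*}$, where $\overline{A^*}$ is a copy of $A^*$, with product $$[f_1+u_1+\bar h_1,\,f_2+u_2+\bar h_2]=f_1u_2-f_2u_1+f_1\nabla h_2-f_2\nabla h_1+[u_1,u_2]+\overline{h_1\varepsilon(u_2)}-\overline{h_2\varepsilon(u_1)}\qquad(u_1,u_2\in R(A^*)).$$ Let $C=A^*+A$ be the null extension, with $(f+a)(g+b)=fg+f\cdot b+a\cdot g$, $f\cdot a=\sum a_{(1)}\langle f,a_{(2)}\rangle$, $a\cdot f=\sum\langle f,a_{(1)}\rangle a_{(2)}$. For a subspace $B\subseteq A$ let $B'=\{b':b\in B\}$ and let $[A^*,B]$ be the span of all $[f,b]$ with $f\in A^*$, $b\in B$; both consist of operators on $C$. Put $L_B=B\oplus B'\oplus[A^*,B]\oplus\bar B$ and $L(A)=L_A$. THEOREM 1. There is a comultiplication $\Delta_L:L(A)\to L(A)\otimes L(A)$ for which $\langle L(A),\Delta_L\rangle$ is a Lie coalgebra with dual algebra $L(A^*)$: the pairing $$\Big\langle f+g'+d+\bar h,\ a+b'+\sum_i[p_i,q_i]+\bar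 c\Big\rangle=\langle f,a\rangle+\langle g,b\rangle+\sum_i\langle p_id,q_i\rangle+\langle h,c\rangle$$ is well defined, identifies $L(A^*)$ with the space of all linear functionals on $L(A)$, and carries the product of $L(A^*)$ to the product of the dual algebra of $\langle L(A),\Delta_L\rangle$. Moreover, $\Delta_L$ is built locally: every element of $L(A)$ lies in $L_B$ for some finite-dimensional subcoalgebra $B$ of $A$, and for each such $B$ the space $L_B$ is finite-dimensional, there is a linear map $\Delta_B:L_B\to L_B\otimes L_B$ which, regarded as a map into $L(A)\otimes L(A)$, is the only linear map from $L_B$ to $L(A)\otimes L(A)$ satisfying $$\langle [x,y],l\rangle=\langle x\otimes y,\Delta_B(l)\rangle\qquad(x,y\in L(A^*),\ l\in L_B),$$ and $\Delta_L$ restricts to $\Delta_B$ on $L_B$. -/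

import Mathlib

open scoped TensorProduct

set_option maxSynthPendingDepth 3

namespace KKT

section Algebra

variable {k V : Type*} [Field k] [AddCommGroup V] [Module k V]

/-- A (linear) Jordan algebra: the product `m` is commutative and `(ab)a² = a(ba²)`. -/
structure IsJordanMul (m : V →ₗ[k] V →ₗ[k] V) : Prop where
  comm : ∀ a b, m a b = m b a
  jordan : ∀ a b, m (m a b) (m a a) = m a (m b (m a a))

/-- A Lie algebra: the product `m` is alternating and satisfies the Jacobi identity. -/
structure IsLieMul (m : V →ₗ[k] V →ₗ[k] V) : Prop where
  self : ∀ a, m a a = 0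
  jacobi : ∀ a b c, m (m a b) c + m (m b c) a + m (m c a) b = 0

/-- `e` is a unity of the algebra `(V, m)`. -/
def IsUnity (m : V →ₗ[k] V →ₗ[k] V) (e : V) : Prop :=
  ∀ a, m e a = a ∧ m a e = a

/-- The operator `a' : x ↦ xa` of right multiplication, as a linear function of `a`. -/
def rmul (m : V →ₗ[k] V →ₗ[k] V) : V →ₗ[k] Module.End k V := m.flip

/-- The commutator `uv - vu` of operators that are written on the right of their argument:
`x ↦ (xu)v - (xv)u`. -/
def rcomm (u v : Module.End k V) : Module.End k V := v ∘ₗ u - u ∘ₗ v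

/-- `[a, b] = a'b' - b'a'`, that is, `x ↦ (xa)b - (xb)a`. -/
def opBracket (m : V →ₗ[k] V →ₗ[k] V) (a b : V) : Module.End k V :=
  rcomm (rmul m a) (rmul m b)

/-- `[X, Y]`, the linear span of the operators `[x, y]` with `x ∈ X` and `y ∈ Y`. -/
def opBracketSpan (m : V →ₗ[k] V →ₗ[k] V) (X Y : Set V) : Submodule k (Module.End k V) :=
  Submodule.span k {u | ∃ x ∈ X, ∃ y ∈ Y, u = opBracket m x y}

/-- `d` is a derivation: `(ab)d = a(bd) + b(ad)`. -/
def IsDer (m : V →ₗ[k] V →ₗ[k] V) (d : Module.End k V) : Prop :=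
  ∀ a b, d (m a b) = m a (d b) + m b (d a)

/-- The space `IntDer` spanned by all `[a, b]`. -/
def intDer (m : V →ₗ[k] V →ₗ[k] V) : Submodule k (Module.End k V) :=
  opBracketSpan m Set.univ Set.univ

@[simp] theorem rmul_apply (m : V →ₗ[k] V →ₗ[k] V) (a x : V) : rmul m a x = m x a := rfl

@[simp] theorem rcomm_apply (u v : Module.End k V) (x : V) :
    rcomm u v x = v (u x) - u (v x) := rfl

@[simp] theorem opBracket_apply (m : V →ₗ[k] V →ₗ[k] V) (a b x : V) :
    opBracket m a b x = m (m x a) b - m (m x b) a := rfl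

theorem opBracket_mem_intDer (m : V →ₗ[k] V →ₗ[k] V) (a b : V) :
    opBracket m a b ∈ intDer m :=
  Submodule.subset_span ⟨a, trivial, b, trivial, rfl⟩

/-- The full linearization of the Jordan identity. -/
theorem IsJordanMul.linearized {m : V →ₗ[k] V →ₗ[k] V} (h : IsJordanMul m)
    (h2 : (2 : k) ≠ 0) (x z w y : V) :
    m (m x y) (m z w) + m (m z y) (m x w) + m (m w y) (m x z)
      - m x (m y (m z w)) - m z (m y (m x w)) - m w (m y (m x z)) = 0 := by
  have e1 := h.jordan (x + z + w) y
  have e2 := h.jordan (x + z) y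
  have e3 := h.jordan (x + w) y
  have e4 := h.jordan (z + w) y
  have e5 := h.jordan x y
  have e6 := h.jordan z y
  have e7 := h.jordan w y
  simp only [map_add, LinearMap.add_apply, h.comm z x, h.comm w x, h.comm w z] at e1 e2 e3 e4
  have key : (2 : k) • (m (m x y) (m z w) + m (m z y) (m x w) + m (m w y) (m x z)
      - m x (m y (m z w)) - m z (m y (m x w)) - m w (m y (m x z))) = 0 := by
    linear_combination (norm := module) e1 - e2 - e3 - e4 + e5 + e6 + e7
  exact (smul_eq_zero.mp key).resolve_left h2

theorem IsJordanMul.isDer_opBracket {m : V →ₗ[k] V →ₗ[k] V} (h : IsJordanMul m)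
    (h2 : (2 : k) ≠ 0) (a b : V) : IsDer m (opBracket m a b) := by
  intro x z
  have e1 := h.linearized h2 x z b a
  have e2 := h.linearized h2 x z a b
  simp only [opBracket_apply, map_sub]
  rw [h.comm b (m a (m x z)), h.comm a (m x z), h.comm a (m z b), h.comm a (m x b)] at e1
  rw [h.comm a (m b (m x z)), h.comm b (m x z), h.comm b (m z a), h.comm b (m x a),
    h.comm (m x b) (m z a), h.comm (m z b) (m x a), h.comm a b] at e2
  linear_combination (norm := module) e2 - e1

theorem IsDer.rcomm_opBracket {m : V →ₗ[k] V →ₗ[k] V} (hc : ∀ a b, m a b = m b a)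
    {d : Module.End k V} (hd : IsDer m d) (a b : V) :
    rcomm (opBracket m a b) d = opBracket m (d a) b + opBracket m a (d b) := by
  ext x
  simp only [rcomm_apply, opBracket_apply, LinearMap.add_apply, map_sub]
  rw [hd (m x a) b, hd (m x b) a, hd x a, hd x b, hc b (_ + _), hc a (_ + _), hc a (d x),
    hc b (d x)]
  simp only [map_add, LinearMap.add_apply]
  abel

theorem IsDer.rcomm_rmul {m : V →ₗ[k] V →ₗ[k] V} (hc : ∀ a b, m a b = m b a)
    {d : Module.End k V} (hd : IsDer m d) (a : V) :
    rcomm (rmul m a) d = rmul m (d a) := by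
  ext x
  simp only [rcomm_apply, rmul_apply]
  rw [hd x a, hc a (d x)]
  abel

theorem IsDer.add {m : V →ₗ[k] V →ₗ[k] V} {d d' : Module.End k V}
    (h : IsDer m d) (h' : IsDer m d') : IsDer m (d + d') := by
  intro a b
  simp only [LinearMap.add_apply, map_add, h a b, h' a b]
  abel

theorem IsDer.smul {m : V →ₗ[k] V →ₗ[k] V} {d : Module.End k V} (c : k)
    (h : IsDer m d) : IsDer m (c • d) := by
  intro a b
  simp only [LinearMap.smul_apply, map_smul, h a b, smul_add]

theorem IsDer.zero (m : V →ₗ[k] V →ₗ[k] V) : IsDer m 0 := by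
  intro a b
  simp

theorem IsDer.rcomm {m : V →ₗ[k] V →ₗ[k] V} (hc : ∀ a b, m a b = m b a)
    {d d' : Module.End k V}
    (h : IsDer m d) (h' : IsDer m d') : IsDer m (rcomm d d') := by
  intro a b
  simp only [rcomm_apply, map_add, h a b, h' a b, h _ (d' _), h' _ (d _), map_sub]
  rw [hc (d b) (d' a), hc (d a) (d' b)]
  abel

theorem IsDer.apply_unity {m : V →ₗ[k] V →ₗ[k] V} {d : Module.End k V}
    (h : IsDer m d) {e : V} (he : IsUnity m e) : d e = 0 := by
  have h1 := h e e
  rw [(he e).1, (he (d e)).1] at h1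
  exact left_eq_add.mp h1

theorem rcomm_swap (u v : Module.End k V) : rcomm u v = -rcomm v u := by
  simp [rcomm]

theorem rcomm_add_left (u v w : Module.End k V) :
    rcomm (u + v) w = rcomm u w + rcomm v w := by
  ext x
  simp only [rcomm_apply, LinearMap.add_apply, map_add]
  abel

theorem rcomm_add_right (u v w : Module.End k V) :
    rcomm u (v + w) = rcomm u v + rcomm u w := by
  ext x
  simp only [rcomm_apply, LinearMap.add_apply, map_add]
  abel

theorem rcomm_smul_left (c : k) (u v : Module.End k V) :
    rcomm (c • u) v = c • rcomm u v := by
  ext x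
  simp only [rcomm_apply, LinearMap.smul_apply, map_smul, smul_sub]

theorem IsJordanMul.isDer_of_mem {m : V →ₗ[k] V →ₗ[k] V} (h : IsJordanMul m)
    (h2 : (2 : k) ≠ 0) {i : Module.End k V} (hi : i ∈ intDer m) : IsDer m i := by
  induction hi using Submodule.span_induction with
  | mem u hu =>
    obtain ⟨a, -, b, -, rfl⟩ := hu
    exact h.isDer_opBracket h2 a b
  | zero => exact IsDer.zero m
  | add u v _ _ hu hv => exact hu.add hv
  | smul c u _ hu => exact hu.smul c

theorem rcomm_mem_intDer {m : V →ₗ[k] V →ₗ[k] V} (hc : ∀ a b, m a b = m b a)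
    {d i : Module.End k V} (hd : IsDer m d) (hi : i ∈ intDer m) : rcomm i d ∈ intDer m := by
  induction hi using Submodule.span_induction with
  | mem u hu =>
    obtain ⟨a, -, b, -, rfl⟩ := hu
    rw [hd.rcomm_opBracket hc]
    exact add_mem (opBracket_mem_intDer m _ _) (opBracket_mem_intDer m _ _)
  | zero =>
    have : rcomm 0 d = 0 := by ext x; simp
    rw [this]
    exact zero_mem _
  | add u v _ _ hu hv => rw [rcomm_add_left]; exact add_mem hu hv
  | smul c u _ hu => rw [rcomm_smul_left]; exact Submodule.smul_mem _ c hu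

end Algebra

section Coalgebra

variable {k A : Type*} [Field k] [AddCommGroup A] [Module k A]

/-- Multiplication of the dual algebra of the coalgebra `(A, Δ)`: `fg = Δ*(ρ(f ⊗ g))`, where
`ρ : A* ⊗ A* → (A ⊗ A)*` is the standard embedding. No identity is imposed on `Δ`. -/
noncomputable def dualMul (Δ : A →ₗ[k] A ⊗[k] A) :
    Module.Dual k A →ₗ[k] Module.Dual k A →ₗ[k] Module.Dual k A :=
  TensorProduct.curry (Δ.dualMap ∘ₗ TensorProduct.dualDistrib k A A)

theorem dualMul_apply (Δ : A →ₗ[k] A ⊗[k] A) (f g : Module.Dual k A) (a : A) :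
    dualMul Δ f g a = TensorProduct.dualDistrib k A A (f ⊗ₜ[k] g) (Δ a) := rfl

/-- A Jordan coalgebra is a coalgebra whose dual algebra is Jordan. -/
def IsJordanCoalgebra (Δ : A →ₗ[k] A ⊗[k] A) : Prop := IsJordanMul (dualMul Δ)

/-- A Lie coalgebra is a coalgebra whose dual algebra is Lie. -/
def IsLieCoalgebra (Δ : A →ₗ[k] A ⊗[k] A) : Prop := IsLieMul (dualMul Δ)

/-- `B` is a subcoalgebra: `Δ(B) ⊆ B ⊗ B`. -/
def IsSubcoalgebra (Δ : A →ₗ[k] A ⊗[k] A) (B : Submodule k A) : Prop :=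
  ∀ b ∈ B, Δ b ∈ LinearMap.range (TensorProduct.mapIncl B B)

/-- The left action `f · a = ∑ a₍₁₎ ⟨f, a₍₂₎⟩` of the dual algebra on `A`. -/
noncomputable def lact (Δ : A →ₗ[k] A ⊗[k] A) (f : Module.Dual k A) : A →ₗ[k] A :=
  (TensorProduct.rid k A).toLinearMap ∘ₗ LinearMap.lTensor A f ∘ₗ Δ

/-- The right action `a · f = ∑ ⟨f, a₍₁₎⟩ a₍₂₎` of the dual algebra on `A`. -/
noncomputable def ract (Δ : A →ₗ[k] A ⊗[k] A) (f : Module.Dual k A) : A →ₗ[k] A :=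
  (TensorProduct.lid k A).toLinearMap ∘ₗ LinearMap.rTensor A f ∘ₗ Δ

/-- The null extension `C = A* + A`: `(f + a)(g + b) = fg + (f · b + a · g)`. -/
noncomputable def nullMul (Δ : A →ₗ[k] A ⊗[k] A) :
    (Module.Dual k A × A) →ₗ[k] (Module.Dual k A × A) →ₗ[k] (Module.Dual k A × A) :=
  LinearMap.mk₂ k (fun x y => (dualMul Δ x.1 y.1, lact Δ x.1 y.2 + ract Δ y.1 x.2))
    (by
      intro x x' y
      ext1
      · simp
      · simp [lact, ract, LinearMap.lTensor_add]; abel)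
    (by
      intro c x y
      ext1
      · simp
      · simp [lact, ract, LinearMap.lTensor_smul])
    (by
      intro x y y'
      ext1
      · simp
      · simp [lact, ract, LinearMap.rTensor_add]; abel)
    (by
      intro c x y
      ext1
      · simp
      · simp [lact, ract, LinearMap.rTensor_smul])

/-- The space `WIntDer(A*)` of weakly inner derivations of the dual algebra: those derivations
that agree with an inner one on each finite-dimensional subcoalgebra. -/
noncomputable def wIntDer (Δ : A →ₗ[k] A ⊗[k] A) :
    Submodule k (Module.End k (Module.Dual k A)) where
  carrier := {d | IsDer (dualMul Δ) d ∧
    ∀ B : Submodule k A, FiniteDimensional k B → IsSubcoalgebra Δ B →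
      ∃ i ∈ intDer (dualMul Δ), ∀ f : Module.Dual k A, ∀ b ∈ B, d f b = i f b}
  add_mem' := by
    rintro d d' ⟨hd, h⟩ ⟨hd', h'⟩
    refine ⟨hd.add hd', fun B hB hs => ?_⟩
    obtain ⟨i, hi, e⟩ := h B hB hs
    obtain ⟨i', hi', e'⟩ := h' B hB hs
    exact ⟨i + i', add_mem hi hi', fun f b hb => by simp [e f b hb, e' f b hb]⟩
  zero_mem' := ⟨IsDer.zero _, fun _ _ _ => ⟨0, zero_mem _, fun _ _ _ => rfl⟩⟩
  smul_mem' := by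
    rintro c d ⟨hd, h⟩
    refine ⟨hd.smul c, fun B hB hs => ?_⟩
    obtain ⟨i, hi, e⟩ := h B hB hs
    exact ⟨c • i, Submodule.smul_mem _ c hi, fun f b hb => by simp [e f b hb]⟩

/-- The space `R(A*) = (A*)' ⊕ WIntDer(A*)` of operators on `A*`. -/
noncomputable def opSpace (Δ : A →ₗ[k] A ⊗[k] A) :
    Submodule k (Module.End k (Module.Dual k A)) :=
  LinearMap.range (rmul (dualMul Δ)) ⊔ wIntDer Δ

theorem rmul_mem_opSpace (Δ : A →ₗ[k] A ⊗[k] A) (f : Module.Dual k A) :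
    rmul (dualMul Δ) f ∈ opSpace Δ :=
  Submodule.mem_sup_left ⟨f, rfl⟩

theorem intDer_le_wIntDer {Δ : A →ₗ[k] A ⊗[k] A} (hJ : IsJordanCoalgebra Δ)
    (h2 : (2 : k) ≠ 0) : intDer (dualMul Δ) ≤ wIntDer Δ :=
  fun i hi => ⟨IsJordanMul.isDer_of_mem hJ h2 hi, fun _ _ _ => ⟨i, hi, fun _ _ _ => rfl⟩⟩

theorem IsSubcoalgebra.dualMul_eq_zero {Δ : A →ₗ[k] A ⊗[k] A} {B : Submodule k A}
    (hs : IsSubcoalgebra Δ B) {f g : Module.Dual k A}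
    (h : (∀ b ∈ B, f b = 0) ∨ (∀ b ∈ B, g b = 0)) : ∀ b ∈ B, dualMul Δ f g b = 0 := by
  intro b hb
  obtain ⟨t, ht⟩ := hs b hb
  rw [dualMul_apply, ← ht]
  clear ht
  induction t with
  | zero => simp
  | tmul x y =>
    rcases h with h | h
    · simp [TensorProduct.mapIncl, h x x.2]
    · simp [TensorProduct.mapIncl, h y y.2]
  | add s t hs' ht' =>
    rw [map_add, map_add, hs', ht', add_zero]

theorem IsSubcoalgebra.intDer_apply_eq_zero {Δ : A →ₗ[k] A ⊗[k] A} {B : Submodule k A}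
    (hs : IsSubcoalgebra Δ B) {i : Module.End k (Module.Dual k A)}
    (hi : i ∈ intDer (dualMul Δ)) {f : Module.Dual k A} (hf : ∀ b ∈ B, f b = 0) :
    ∀ b ∈ B, i f b = 0 := by
  intro b hb
  induction hi using Submodule.span_induction with
  | mem u hu =>
    obtain ⟨p, -, q, -, rfl⟩ := hu
    rw [opBracket_apply, LinearMap.sub_apply,
      hs.dualMul_eq_zero (.inl (hs.dualMul_eq_zero (.inl hf))) b hb,
      hs.dualMul_eq_zero (.inl (hs.dualMul_eq_zero (.inl hf))) b hb, sub_zero]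
  | zero => simp
  | add u v _ _ hu hv => simp [hu, hv]
  | smul c u _ hu => simp [hu]

theorem rcomm_mem_wIntDer {Δ : A →ₗ[k] A ⊗[k] A} (hJ : IsJordanCoalgebra Δ)
    (h2 : (2 : k) ≠ 0) {d d' : Module.End k (Module.Dual k A)}
    (hd : d ∈ wIntDer Δ) (hd' : d' ∈ wIntDer Δ) : rcomm d d' ∈ wIntDer Δ := by
  refine ⟨hd.1.rcomm hJ.comm hd'.1, fun B hB hs => ?_⟩
  obtain ⟨i, hi, e⟩ := hd.2 B hB hs
  obtain ⟨i', hi', e'⟩ := hd'.2 B hB hs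
  refine ⟨rcomm i i', rcomm_mem_intDer hJ.comm (IsJordanMul.isDer_of_mem hJ h2 hi') hi,
    fun f b hb => ?_⟩
  have h1 := hs.intDer_apply_eq_zero hi' (f := d f - i f)
    (fun b hb => by simp [e f b hb]) b hb
  have h3 := hs.intDer_apply_eq_zero hi (f := d' f - i' f)
    (fun b hb => by simp [e' f b hb]) b hb
  rw [map_sub, LinearMap.sub_apply, sub_eq_zero] at h1 h3
  rw [rcomm_apply, rcomm_apply, LinearMap.sub_apply, LinearMap.sub_apply, e' _ b hb,
    e _ b hb, h1, h3]

theorem opBracket_mem_opSpace {Δ : A →ₗ[k] A ⊗[k] A} (hJ : IsJordanCoalgebra Δ)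
    (h2 : (2 : k) ≠ 0) (f g : Module.Dual k A) :
    opBracket (dualMul Δ) f g ∈ opSpace Δ :=
  Submodule.mem_sup_right (intDer_le_wIntDer hJ h2 (opBracket_mem_intDer _ f g))

theorem rcomm_mem_opSpace {Δ : A →ₗ[k] A ⊗[k] A} (hJ : IsJordanCoalgebra Δ)
    (h2 : (2 : k) ≠ 0) {u v : Module.End k (Module.Dual k A)}
    (hu : u ∈ opSpace Δ) (hv : v ∈ opSpace Δ) : rcomm u v ∈ opSpace Δ := by
  obtain ⟨_, ⟨f, rfl⟩, d, hd, rfl⟩ := Submodule.mem_sup.mp hu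
  obtain ⟨_, ⟨g, rfl⟩, d', hd', rfl⟩ := Submodule.mem_sup.mp hv
  rw [rcomm_add_left, rcomm_add_right, rcomm_add_right, rcomm_swap d,
    hd.1.rcomm_rmul hJ.comm, hd'.1.rcomm_rmul hJ.comm]
  exact add_mem (add_mem (opBracket_mem_opSpace hJ h2 f g) (rmul_mem_opSpace Δ _))
    (add_mem (neg_mem (rmul_mem_opSpace Δ _))
      (Submodule.mem_sup_right (rcomm_mem_wIntDer hJ h2 hd hd')))

/-- The space `L(A*) = A* ⊕ R(A*) ⊕ Ā*` with `R(A*) = (A*)' ⊕ WIntDer(A*)`; the triple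
`(f, u, h)` stands for `f + u + h̄`. -/
abbrev KKTAlg (Δ : A →ₗ[k] A ⊗[k] A) : Type _ :=
  Module.Dual k A × opSpace Δ × Module.Dual k A

/-- The commutator on `R(A*)`. -/
noncomputable def opComm {Δ : A →ₗ[k] A ⊗[k] A} (hJ : IsJordanCoalgebra Δ)
    (h2 : (2 : k) ≠ 0) (u v : opSpace Δ) : opSpace Δ :=
  ⟨rcomm u v, rcomm_mem_opSpace hJ h2 u.2 v.2⟩

/-- `f ∇ g = (fg)' - [f, g]`. -/
noncomputable def nabla {Δ : A →ₗ[k] A ⊗[k] A} (hJ : IsJordanCoalgebra Δ)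
    (h2 : (2 : k) ≠ 0) (f g : Module.Dual k A) : opSpace Δ :=
  ⟨rmul (dualMul Δ) (dualMul Δ f g) - opBracket (dualMul Δ) f g,
    sub_mem (rmul_mem_opSpace Δ _) (opBracket_mem_opSpace hJ h2 f g)⟩

/-- The map `ε : f' + d ↦ -f' + d` of `R(A*)` into itself. Derivations kill the unity `e`, so
`f` is the value of `f' + d` at `e`. -/
noncomputable def eps (Δ : A →ₗ[k] A ⊗[k] A) (e : Module.Dual k A) (u : opSpace Δ) :
    opSpace Δ :=
  u - (2 : k) • ⟨rmul (dualMul Δ) (u.1 e), rmul_mem_opSpace Δ _⟩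

theorem eps_eq {Δ : A →ₗ[k] A ⊗[k] A} {e : Module.Dual k A} (he : IsUnity (dualMul Δ) e)
    (u : opSpace Δ) (f : Module.Dual k A) (d : Module.End k (Module.Dual k A))
    (hd : d ∈ wIntDer Δ) (hu : u.1 = rmul (dualMul Δ) f + d) :
    (eps Δ e u).1 = -rmul (dualMul Δ) f + d := by
  have h1 : u.1 e = f := by
    rw [hu, LinearMap.add_apply, hd.1.apply_unity he, add_zero]
    exact (he f).1
  simp only [eps, Submodule.coe_sub, Submodule.coe_smul, h1]
  rw [hu]
  module

/-- The product on `L(A*)`: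
`[f₁ + u₁ + h̄₁, f₂ + u₂ + h̄₂]` is
`f₁u₂ - f₂u₁ + f₁∇h₂ - f₂∇h₁ + [u₁, u₂]` plus the bar of `h₁ε(u₂) - h₂ε(u₁)`. -/
noncomputable def kktBracket {Δ : A →ₗ[k] A ⊗[k] A} (hJ : IsJordanCoalgebra Δ)
    (h2 : (2 : k) ≠ 0) (e : Module.Dual k A) (x y : KKTAlg Δ) : KKTAlg Δ :=
  (y.2.1.1 x.1 - x.2.1.1 y.1,
    nabla hJ h2 x.1 y.2.2 - nabla hJ h2 y.1 x.2.2 + opComm hJ h2 x.2.1 y.2.1,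
    (eps Δ e y.2.1).1 x.2.2 - (eps Δ e x.2.1).1 y.2.2)

/-- The operator `a'` on the null extension `C = A* + A`, for `a ∈ A`. -/
noncomputable def prime (Δ : A →ₗ[k] A ⊗[k] A) :
    A →ₗ[k] Module.End k (Module.Dual k A × A) :=
  rmul (nullMul Δ) ∘ₗ LinearMap.inr k (Module.Dual k A) A

/-- The operator `[f, a]` on the null extension `C = A* + A`, for `f ∈ A*` and `a ∈ A`. -/
noncomputable def mixed (Δ : A →ₗ[k] A ⊗[k] A) (f : Module.Dual k A) (a : A) :
    Module.End k (Module.Dual k A × A) :=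
  opBracket (nullMul Δ) (f, 0) (0, a)

/-- The space `B' ⊕ [A*, B]` of operators on the null extension, for a subspace `B` of `A`. -/
noncomputable def coOpPiece (Δ : A →ₗ[k] A ⊗[k] A) (B : Submodule k A) :
    Submodule k (Module.End k (Module.Dual k A × A)) :=
  B.map (prime Δ) ⊔ Submodule.span k {u | ∃ f : Module.Dual k A, ∃ b ∈ B, u = mixed Δ f b}

/-- The space `R(A) = A' ⊕ [A*, A]`. -/
noncomputable def coOpSpace (Δ : A →ₗ[k] A ⊗[k] A) :
    Submodule k (Module.End k (Module.Dual k A × A)) :=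
  coOpPiece Δ ⊤

/-- The space `L(A) = A ⊕ A' ⊕ [A*, A] ⊕ Ā`; the triple `(a, w, c)` stands for `a + w + c̄`,
where `w` lies in `R(A) = A' ⊕ [A*, A]`. -/
abbrev KKTCoalg (Δ : A →ₗ[k] A ⊗[k] A) : Type _ := A × coOpSpace Δ × A

/-- The subspace `B ⊕ B' ⊕ [A*, B] ⊕ B̄` of `L(A)`. -/
noncomputable def piece (Δ : A →ₗ[k] A ⊗[k] A) (B : Submodule k A) :
    Submodule k (KKTCoalg Δ) :=
  B.prod (((coOpPiece Δ B).submoduleOf (coOpSpace Δ)).prod B)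

/-- `Φ` is the canonical pairing of `L(A*)` with `L(A)`:
`⟨f + g' + d + h̄, a + b' + ∑ [pᵢ, qᵢ] + c̄⟩ = f(a) + g(b) + ∑ (pᵢd)(qᵢ) + h(c)`. -/
def IsCanonicalPairing (Δ : A →ₗ[k] A ⊗[k] A)
    (Φ : KKTAlg Δ →ₗ[k] Module.Dual k (KKTCoalg Δ)) : Prop :=
  ∀ (x : KKTAlg Δ) (l : KKTCoalg Δ) (g : Module.Dual k A)
    (d : Module.End k (Module.Dual k A)) (b : A) (n : ℕ) (p : Fin n → Module.Dual k A)
    (q : Fin n → A), d ∈ wIntDer Δ → x.2.1.1 = rmul (dualMul Δ) g + d →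
    l.2.1.1 = prime Δ b + ∑ i, mixed Δ (p i) (q i) →
    Φ x l = x.1 l.1 + g b + ∑ i, d (p i) (q i) + x.2.2 l.2.2

end Coalgebra

end KKT

/-! The product of `L(A*)` is given, so only a comultiplication inducing it has to be found. For
fixed `l` the form `(x, y) ↦ ⟨[x, y], l⟩` comes from a tensor in `L_B ⊗ L_B` once `L_B` is
finite-dimensional, contains `l`, and has an ideal of `L(A*)` as annihilator
(`exists_tensor_of_bilinear`). Functionals separate tensors, so the tensor is unique and the local
choices form one linear map (`exists_comultiplication`). Four facts feed this argument.

Local finiteness (`IsJordanCoalgebra.exists_subcoalgebra`): transposed to `A`, the linearized Jordan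
identity reverses a product of three operators up to sign and shorter products. Hence long products
shorten, and each element lies in a finite-dimensional subcoalgebra.

Duality: the identity `⟨g, f[p, q]⟩ = ⟨p[f, g], q⟩` (`apply_mixed`) makes the pairing of `[A*, A]`
with inner derivations well defined, and local finiteness extends this to weakly inner ones. Read
backwards on the finite-dimensional spaces `[A*, B]`, it shows that every functional is locally an
inner derivation (`exists_wIntDer_eq`). Evaluation at the unity separates `g'` from `d` and `b'`
from `∑ [pᵢ, qᵢ]`.

Lie identities (`isLieMul_kktBracketHom`): this is the Kantor-Koecher-Tits construction; it rests on
the symmetry of the Jordan triple product, on the commutator formula `rcomm_nablaHom`, and on `ε`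
preserving commutators.

Ideals (`vanishesOn_kktBracket`): the annihilator of a finite-dimensional subcoalgebra is an ideal
of `A*` stable under weakly inner derivations, and this passes to `L(A*)`. -/

namespace KKT

/-! ### Tensors and bilinear forms on a dual space -/

section LinearAlgebra

variable {k V : Type*} [Field k] [AddCommGroup V] [Module k V]

/-- Pure tensors of functionals separate the points of `V ⊗ V`. -/
theorem eq_of_dualDistrib_eq {s t : V ⊗[k] V}
    (h : ∀ f g : Module.Dual k V, TensorProduct.dualDistrib k V V (f ⊗ₜ g) s =
      TensorProduct.dualDistrib k V V (f ⊗ₜ g) t) : s = t := by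
  let b := Module.Basis.ofVectorSpace k V
  have key : ∀ (t : V ⊗[k] V) (i j), (b.tensorProduct b).repr t (i, j) =
      TensorProduct.dualDistrib k V V (b.coord i ⊗ₜ b.coord j) t := by
    intro t i j
    induction t with
    | zero => simp
    | tmul x y => simp [Module.Basis.tensorProduct_repr_tmul_apply, mul_comm]
    | add x y hx hy => rw [map_add, map_add, Finsupp.add_apply, hx, hy]
  apply (b.tensorProduct b).repr.injective
  ext ⟨i, j⟩
  rw [key, key, h]

theorem exists_projection (P : Submodule k V) :
    ∃ π : V →ₗ[k] P, ∀ x : P, π x = x := by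
  obtain ⟨π, hπ⟩ := P.subtype.exists_leftInverse_of_injective P.ker_subtype
  exact ⟨π, fun x => LinearMap.congr_fun hπ x⟩

theorem dualDistrib_mapIncl (P : Submodule k V) (f g : Module.Dual k V) (t : P ⊗[k] P) :
    TensorProduct.dualDistrib k V V (f ⊗ₜ g) (TensorProduct.mapIncl P P t) =
      TensorProduct.dualDistrib k P P ((f ∘ₗ P.subtype) ⊗ₜ (g ∘ₗ P.subtype)) t := by
  induction t with
  | zero => simp
  | tmul x y => simp [TensorProduct.mapIncl]
  | add x y hx hy => simp only [map_add, hx, hy]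

/-- Functionals on `P` extend to `V` through a projection, so functionals on `V` already separate
the tensors over `P`. -/
theorem mapIncl_injective (P : Submodule k V) :
    Function.Injective (TensorProduct.mapIncl P P) := by
  intro s t hst
  obtain ⟨π, hπ⟩ := exists_projection P
  have hc : ∀ f : Module.Dual k P, (f ∘ₗ π) ∘ₗ P.subtype = f := fun f => by
    ext x
    simp [hπ]
  refine eq_of_dualDistrib_eq fun f g => ?_
  have := congrArg (TensorProduct.dualDistrib k V V ((f ∘ₗ π) ⊗ₜ (g ∘ₗ π))) hst
  rwa [dualDistrib_mapIncl, dualDistrib_mapIncl, hc, hc] at this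

/-- A bilinear form on the dual of `V` whose radicals contain the annihilator of a
finite-dimensional subspace `P` is given by an element of `P ⊗ P`. -/
theorem exists_tensor_of_bilinear (P : Submodule k V) [FiniteDimensional k P]
    (β : Module.Dual k V →ₗ[k] Module.Dual k V →ₗ[k] k)
    (hl : ∀ f g : Module.Dual k V, (∀ x ∈ P, f x = 0) → β f g = 0)
    (hr : ∀ f g : Module.Dual k V, (∀ x ∈ P, g x = 0) → β f g = 0) :
    ∃ t : P ⊗[k] P, ∀ f g : Module.Dual k V,
      TensorProduct.dualDistrib k V V (f ⊗ₜ g) (TensorProduct.mapIncl P P t) = β f g := by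
  obtain ⟨π, hπ⟩ := exists_projection P
  let b := Module.finBasis k P
  let c : Fin (Module.finrank k P) → Module.Dual k V := fun i => b.coord i ∘ₗ π
  -- The `c i` extend the dual basis of `P`, so modulo the annihilator of `P` every functional is a
  -- combination of them and `β` is determined by its values `β (c i) (c j)`.
  have hsum : ∀ f : Module.Dual k V, ∀ x ∈ P, (f - ∑ i, f (b i) • c i) x = 0 := by
    intro f x hx
    have h1 : f x = ∑ i, b.repr ⟨x, hx⟩ i * f (b i) := by
      have := congrArg (f ∘ₗ P.subtype) (b.sum_repr ⟨x, hx⟩)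
      simpa only [map_sum, map_smul, LinearMap.comp_apply, Submodule.subtype_apply,
        smul_eq_mul] using this.symm
    have h2 : π x = ⟨x, hx⟩ := hπ ⟨x, hx⟩
    simp only [LinearMap.sub_apply, LinearMap.sum_apply, LinearMap.smul_apply, c,
      LinearMap.comp_apply, h2, h1, smul_eq_mul, Module.Basis.coord_apply, sub_eq_zero]
    exact Finset.sum_congr rfl fun i _ => mul_comm _ _
  have hβ : ∀ f g : Module.Dual k V,
      β f g = β (∑ i, f (b i) • c i) (∑ i, g (b i) • c i) := by
    intro f g
    have e1 := hl _ g (hsum f)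
    have e2 := hr (∑ i, f (b i) • c i) _ (hsum g)
    rw [map_sub, LinearMap.sub_apply, sub_eq_zero] at e1
    rw [map_sub, sub_eq_zero] at e2
    rw [e1, e2]
  refine ⟨∑ i, ∑ j, β (c i) (c j) • (b i ⊗ₜ b j), fun f g => ?_⟩
  rw [hβ, dualDistrib_mapIncl]
  simp only [map_sum, map_smul, TensorProduct.dualDistrib_apply, LinearMap.sum_apply,
    LinearMap.smul_apply, LinearMap.comp_apply, Submodule.subtype_apply, smul_eq_mul,
    Finset.mul_sum]
  rw [Finset.sum_comm]
  refine Finset.sum_congr rfl fun j _ => Finset.sum_congr rfl fun i _ => ?_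
  ring

/-- A linear map with values in the range of an injective linear map factors through it. -/
theorem exists_factorization {X Y Z : Type*} [AddCommGroup X] [Module k X] [AddCommGroup Y]
    [Module k Y] [AddCommGroup Z] [Module k Z] (f : X →ₗ[k] Z) (hf : Function.Injective f)
    (T : Y →ₗ[k] Z) (hT : ∀ y, ∃ x, f x = T y) : ∃ g : Y →ₗ[k] X, ∀ y, f (g y) = T y := by
  obtain ⟨h, hh⟩ := f.exists_leftInverse_of_injective (LinearMap.ker_eq_bot.mpr hf)
  refine ⟨h ∘ₗ T, fun y => ?_⟩
  obtain ⟨x, hx⟩ := hT y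
  have : h (f x) = x := LinearMap.congr_fun hh x
  rw [LinearMap.comp_apply, ← hx, this]

theorem exists_section {X Y : Type*} [AddCommGroup X] [Module k X] [AddCommGroup Y]
    [Module k Y] (f : X →ₗ[k] Y) : ∃ s : LinearMap.range f →ₗ[k] X, ∀ y, f (s y) = y := by
  obtain ⟨s, hs⟩ := f.rangeRestrict.exists_rightInverse_of_surjective f.range_rangeRestrict
  exact ⟨s, fun y => congrArg Subtype.val (LinearMap.congr_fun hs y)⟩

end LinearAlgebra

/-! ### Shortening words in operators that satisfy a reversal identity -/

section LocalFiniteness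

variable {k F A : Type*} [Field k] [AddCommGroup F] [Module k F] [AddCommGroup A] [Module k A]

/-- The span of the vectors obtained from `a` by at most `n` operators `op f`. -/
def wordSpan (op : F →ₗ[k] Module.End k A) (a : A) : ℕ → Submodule k A
  | 0 => Submodule.span k {a}
  | n + 1 => wordSpan op a n ⊔ Submodule.map₂ op ⊤ (wordSpan op a n)

theorem wordSpan_le_succ (op : F →ₗ[k] Module.End k A) (a : A) (n : ℕ) :
    wordSpan op a n ≤ wordSpan op a (n + 1) := le_sup_left

theorem wordSpan_mono (op : F →ₗ[k] Module.End k A) (a : A) : Monotone (wordSpan op a) :=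
  monotone_nat_of_le_succ (wordSpan_le_succ op a)

theorem op_mem_wordSpan (op : F →ₗ[k] Module.End k A) (a : A) {n : ℕ} (f : F) {v : A}
    (hv : v ∈ wordSpan op a n) : op f v ∈ wordSpan op a (n + 1) :=
  Submodule.mem_sup_right (Submodule.apply_mem_map₂ op trivial hv)

theorem mem_wordSpan_self (op : F →ₗ[k] Module.End k A) (a : A) : a ∈ wordSpan op a 0 :=
  Submodule.mem_span_singleton_self a

/-- The successive action of the operators of a list. -/
def word (op : F →ₗ[k] Module.End k A) : List F → A →ₗ[k] A
  | [] => LinearMap.id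
  | f :: l => word op l ∘ₗ op f

@[simp] theorem word_nil (op : F →ₗ[k] Module.End k A) (v : A) : word op [] v = v := rfl

@[simp] theorem word_cons (op : F →ₗ[k] Module.End k A) (f : F) (l : List F) (v : A) :
    word op (f :: l) v = word op l (op f v) := rfl

theorem word_mem_wordSpan (op : F →ₗ[k] Module.End k A) (a : A) {n m : ℕ} (l : List F) {v : A}
    (hv : v ∈ wordSpan op a n) (hm : n + l.length ≤ m) : word op l v ∈ wordSpan op a m := by
  induction l generalizing n v with
  | nil => exact wordSpan_mono op a (by simpa using hm) hv
  | cons f l ih =>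
    rw [word_cons]
    refine ih (op_mem_wordSpan op a f hv) ?_
    simp only [List.length_cons] at hm
    omega

/-- The identity satisfied by the multiplication operators of a Jordan bimodule; it reverses a
product of three operators, up to sign and shorter products. -/
def TripleReversal (op : F →ₗ[k] Module.End k A) (m : F → F → F) : Prop :=
  ∀ x y z v, op z (op y (op x v)) + op x (op y (op z v)) =
    op z (op (m x y) v) + op x (op (m y z) v) + op y (op (m x z) v) - op (m (m x z) y) v

/-- Induction on the codimension of the space `E` of letters that do not lengthen `v`. If the first
letter `x` is outside `E`, reversal shows that no letter of `E + kx` lengthens `op g (op x v)`. Two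
letters are thus spent to lower the codimension by at least one, and one more is absorbed when `E`
is everything, whence `2s + 1`. -/
theorem TripleReversal.word_mem {op : F →ₗ[k] Module.End k A} {m : F → F → F}
    (h : TripleReversal op m) (h2 : (2 : k) ≠ 0) (a : A) (s : ℕ) :
    ∀ (n : ℕ) (v : A) (E : Submodule k F), v ∈ wordSpan op a n →
      (∀ u ∈ E, op u v ∈ wordSpan op a n) → FiniteDimensional k (F ⧸ E) →
      Module.finrank k (F ⧸ E) ≤ s →
      ∀ l : List F, l.length = 2 * s + 1 → word op l v ∈ wordSpan op a (n + 2 * s) := by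
  induction s with
  | zero =>
    intro n v E hv hE hfd hs l hl
    obtain ⟨x, rfl⟩ := List.length_eq_one_iff.mp hl
    have : Subsingleton (F ⧸ E) := Module.finrank_zero_iff.mp (Nat.le_zero.mp hs)
    have hE' : E = ⊤ := Submodule.Quotient.subsingleton_iff.mp this
    exact hE x (hE' ▸ trivial)
  | succ s ih =>
    intro n v E hv hE hfd hs l hl
    obtain ⟨x, l, rfl⟩ := List.exists_cons_of_length_eq_add_one hl
    obtain ⟨g, l, rfl⟩ := List.exists_cons_of_length_eq_add_one (n := 2 * s + 1)
      (by simpa [Nat.mul_succ] using hl)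
    simp only [List.length_cons] at hl
    -- If `x ∈ E`, it costs no length, and the remaining `2s + 2` letters stay within the bound.
    by_cases hx : x ∈ E
    · rw [word_cons]
      exact word_mem_wordSpan op a _ (hE x hx) (by simp only [List.length_cons]; omega)
    · have shorter : ∀ p q, op p (op q v) ∈ wordSpan op a (n + 2) := fun p q =>
        op_mem_wordSpan op a p (op_mem_wordSpan op a q hv)
      have rest : ∀ u, op u (op g (op x v)) + op x (op g (op u v)) ∈ wordSpan op a (n + 2) := by
        intro u
        rw [h x g u v]
        exact sub_mem (add_mem (add_mem (shorter _ _) (shorter _ _)) (shorter _ _))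
          (wordSpan_le_succ op a _ (op_mem_wordSpan op a _ hv))
      have hv2 : op g (op x v) ∈ wordSpan op a (n + 2) := shorter g x
      have hfd' : FiniteDimensional k (F ⧸ (E ⊔ Submodule.span k {x})) :=
        Module.Finite.of_surjective (Submodule.factor le_sup_left)
          (Submodule.factor_surjective (le_sup_left : E ≤ E ⊔ Submodule.span k {x}))
      have hlt : Module.finrank k (F ⧸ (E ⊔ Submodule.span k {x})) <
          Module.finrank k (F ⧸ E) := by
        have hsurj := Submodule.factor_surjective (le_sup_left : E ≤ E ⊔ Submodule.span k {x})
        refine lt_of_le_of_ne (LinearMap.finrank_le_finrank_of_surjective hsurj) fun heq => hx ?_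
        have hinj := (LinearMap.injective_iff_surjective_of_finrank_eq_finrank heq.symm).mpr hsurj
        have hxE : Submodule.Quotient.mk (p := E) x = 0 := by
          apply hinj
          rw [map_zero]
          exact (Submodule.Quotient.mk_eq_zero _).mpr
            (Submodule.mem_sup_right (Submodule.mem_span_singleton_self x))
        exact (Submodule.Quotient.mk_eq_zero _).mp hxE
      have := ih (n + 2) (op g (op x v)) (E ⊔ Submodule.span k {x}) hv2 ?_ hfd' (by omega) l
        (by omega)
      · rw [word_cons, word_cons]
        rwa [show n + 2 * (s + 1) = n + 2 + 2 * s by ring]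
      · intro u hu
        obtain ⟨u, huE, w, hw, rfl⟩ := Submodule.mem_sup.mp hu
        obtain ⟨c, rfl⟩ := Submodule.mem_span_singleton.mp hw
        rw [map_add, map_smul, LinearMap.add_apply, LinearMap.smul_apply]
        refine add_mem ?_ (Submodule.smul_mem _ c ?_)
        · have h1 : op x (op g (op u v)) ∈ wordSpan op a (n + 2) :=
            op_mem_wordSpan op a x (op_mem_wordSpan op a g (hE u huE))
          simpa using sub_mem (rest u) h1
        -- For `u = x` the two reversed words coincide, so twice the word is short; here
        -- characteristic not 2 is needed.
        · have h1 := rest x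
          rw [← two_smul k] at h1
          exact (Submodule.smul_mem_iff _ h2).mp h1

/-- A vector of `wordSpan op a n` is a combination of words of length at most `n` in `a`; the longer
word then has length at most `N + 1`, and the extreme case is the hypothesis. For `n = N` this gives
stability under every operator. -/
theorem op_word_mem_of_forall (op : F →ₗ[k] Module.End k A) (a : A) {N : ℕ}
    (h : ∀ l : List F, l.length = N + 1 → word op l a ∈ wordSpan op a N) {n : ℕ} (hn : n ≤ N)
    {v : A} (hv : v ∈ wordSpan op a n) (l : List F) (hl : l.length = N + 1 - n) :
    word op l v ∈ wordSpan op a N := by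
  induction n generalizing v l with
  | zero =>
    obtain ⟨c, rfl⟩ := Submodule.mem_span_singleton.mp hv
    rw [map_smul]
    exact Submodule.smul_mem _ c (h l (by omega))
  | succ n ih =>
    obtain ⟨v, hv', w, hw, rfl⟩ := Submodule.mem_sup.mp hv
    rw [map_add]
    refine add_mem (word_mem_wordSpan op a (n := n) l hv' (by omega)) ?_
    have hle : Submodule.map₂ op ⊤ (wordSpan op a n) ≤
        (wordSpan op a N).comap (word op l) := Submodule.map₂_le.mpr fun f _ w hw =>
      ih (by omega) hw (f :: l) (by simp only [List.length_cons]; omega)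
    exact hle hw

theorem finiteDimensional_map₂_top (op : F →ₗ[k] Module.End k A)
    (hop : ∀ v, FiniteDimensional k (LinearMap.range (op.flip v))) (W : Submodule k A)
    (hW : W.FG) : (Submodule.map₂ op ⊤ W).FG := by
  refine Submodule.fg_induction (motive := fun W _ => (Submodule.map₂ op ⊤ W).FG) (fun v => ?_)
    (fun W W' _ _ h h' => ?_) W hW
  · have hle : Submodule.map₂ op ⊤ (Submodule.span k {v}) ≤ LinearMap.range (op.flip v) := by
      refine Submodule.map₂_le.mpr fun f _ w hw => ?_
      obtain ⟨c, rfl⟩ := Submodule.mem_span_singleton.mp hw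
      exact ⟨c • f, by simp⟩
    have := hop v
    have := Submodule.finiteDimensional_of_le hle
    exact Module.Finite.iff_fg.mp this
  · rw [Submodule.map₂_sup_right]
    exact h.sup h'

/-- The letters killing `a` have finite codimension `s`, so words of length `2s + 1` in `a` shorten,
and the words of length at most `2s` span a stable space. -/
theorem TripleReversal.exists_stable {op : F →ₗ[k] Module.End k A} {m : F → F → F}
    (h : TripleReversal op m) (h2 : (2 : k) ≠ 0)
    (hop : ∀ v, FiniteDimensional k (LinearMap.range (op.flip v))) (a : A) :
    ∃ B : Submodule k A, FiniteDimensional k B ∧ a ∈ B ∧ ∀ f, ∀ b ∈ B, op f b ∈ B := by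
  let E := LinearMap.ker (op.flip a)
  have hE : FiniteDimensional k (F ⧸ E) := by
    have := hop a
    exact Module.Finite.equiv (op.flip a).quotKerEquivRange.symm
  set s := Module.finrank k (F ⧸ E) with hs
  have hfg : ∀ n, (wordSpan op a n).FG := by
    intro n
    induction n with
    | zero => exact Submodule.fg_span_singleton a
    | succ n ih => exact ih.sup (finiteDimensional_map₂_top op hop _ ih)
  refine ⟨wordSpan op a (2 * s), Module.Finite.iff_fg.mpr (hfg _),
    wordSpan_mono op a (Nat.zero_le _) (mem_wordSpan_self op a), fun f b hb => ?_⟩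
  refine op_word_mem_of_forall op a (fun l hl => ?_) le_rfl hb [f]
    (by simp only [List.length_cons, List.length_nil]; omega)
  have := h.word_mem h2 a s 0 a E (mem_wordSpan_self op a) ?_ hE le_rfl l hl
  · simpa using this
  · intro u hu
    have : op u a = 0 := hu
    rw [this]
    exact zero_mem _

end LocalFiniteness

/-! ### Jordan coalgebras are locally finite-dimensional -/

section Coalgebra

variable {k A : Type*} [Field k] [AddCommGroup A] [Module k A] {Δ : A →ₗ[k] A ⊗[k] A}

theorem apply_lact (f g : Module.Dual k A) (a : A) : g (lact Δ f a) = dualMul Δ g f a := by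
  rw [dualMul_apply, lact, LinearMap.comp_apply, LinearMap.comp_apply]
  induction Δ a with
  | zero => simp
  | tmul x y => simp [mul_comm]
  | add x y hx hy => simp only [map_add, hx, hy]

theorem apply_ract (f g : Module.Dual k A) (a : A) : g (ract Δ f a) = dualMul Δ f g a := by
  rw [dualMul_apply, ract, LinearMap.comp_apply, LinearMap.comp_apply]
  induction Δ a with
  | zero => simp
  | tmul x y => simp
  | add x y hx hy => simp only [map_add, hx, hy]

theorem eq_of_forall_dual {a b : A} (h : ∀ g : Module.Dual k A, g a = g b) : a = b := by
  rw [← sub_eq_zero, ← Module.forall_dual_apply_eq_zero_iff k]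
  intro g
  rw [map_sub, h, sub_self]

theorem isSubcoalgebra_of_stable {B : Submodule k A} (hl : ∀ f, ∀ b ∈ B, lact Δ f b ∈ B)
    (hr : ∀ f, ∀ b ∈ B, ract Δ f b ∈ B) : IsSubcoalgebra Δ B := by
  intro b hb
  obtain ⟨π, hπ⟩ := exists_projection B
  have hπ' : ∀ x ∈ B, (π x : A) = x := fun x hx => congrArg Subtype.val (hπ ⟨x, hx⟩)
  -- Projecting both factors to `B` leaves `Δ b` unchanged: stability under one action removes the
  -- projection from one factor, stability under the other action removes it from the other.
  refine ⟨TensorProduct.map π π (Δ b), eq_of_dualDistrib_eq fun f g => ?_⟩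
  have h1 : ∀ t : A ⊗[k] A, TensorProduct.dualDistrib k A A (f ⊗ₜ g)
      (TensorProduct.mapIncl B B (TensorProduct.map π π t)) =
      TensorProduct.dualDistrib k A A ((f ∘ₗ B.subtype ∘ₗ π) ⊗ₜ (g ∘ₗ B.subtype ∘ₗ π)) t := by
    intro t
    induction t with
    | zero => simp
    | tmul x y => simp [TensorProduct.mapIncl]
    | add x y hx hy => simp only [map_add, hx, hy]
  rw [h1, ← dualMul_apply, ← dualMul_apply, ← apply_lact, ← apply_ract]
  simp only [LinearMap.comp_apply, Submodule.subtype_apply]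
  rw [hπ' _ (hl _ b hb), apply_lact, ← apply_ract]
  simp only [LinearMap.comp_apply, Submodule.subtype_apply]
  rw [hπ' _ (hr _ b hb)]

theorem IsSubcoalgebra.sup {B B' : Submodule k A} (h : IsSubcoalgebra Δ B)
    (h' : IsSubcoalgebra Δ B') : IsSubcoalgebra Δ (B ⊔ B') := by
  intro b hb
  obtain ⟨x, hx, y, hy, rfl⟩ := Submodule.mem_sup.mp hb
  rw [map_add]
  exact add_mem
    (TensorProduct.range_mapIncl_mono le_sup_left le_sup_left (h x hx))
    (TensorProduct.range_mapIncl_mono le_sup_right le_sup_right (h' y hy))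

/-- The operators `lact Δ f`, as a linear function of `f`. -/
noncomputable def lactHom (Δ : A →ₗ[k] A ⊗[k] A) : Module.Dual k A →ₗ[k] Module.End k A where
  toFun := lact Δ
  map_add' f g := by
    ext a
    simp [lact, LinearMap.lTensor_add]
  map_smul' c f := by
    ext a
    simp [lact, LinearMap.lTensor_smul]

theorem lactHom_apply (f : Module.Dual k A) : lactHom Δ f = lact Δ f := rfl

/-- All values lie in the span of the finitely many left tensor factors of one expression for `Δ a`.
-/
theorem finiteDimensional_range_lactHom_flip (a : A) :
    FiniteDimensional k (LinearMap.range ((lactHom Δ).flip a)) := by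
  have key : ∀ t : A ⊗[k] A, ∃ W : Submodule k A, W.FG ∧ ∀ f : Module.Dual k A,
      TensorProduct.rid k A (LinearMap.lTensor A f t) ∈ W := by
    intro t
    induction t with
    | zero => exact ⟨⊥, Submodule.fg_bot, fun f => by simp⟩
    | tmul x y =>
      exact ⟨Submodule.span k {x}, Submodule.fg_span_singleton x, fun f => by
        simpa using Submodule.smul_mem _ _ (Submodule.mem_span_singleton_self x)⟩
    | add x y hx hy =>
      obtain ⟨W, hW, h⟩ := hx
      obtain ⟨W', hW', h'⟩ := hy
      refine ⟨W ⊔ W', hW.sup hW', fun f => ?_⟩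
      rw [map_add, map_add]
      exact add_mem (Submodule.mem_sup_left (h f)) (Submodule.mem_sup_right (h' f))
  obtain ⟨W, hW, h⟩ := key (Δ a)
  have : FiniteDimensional k W := Module.Finite.iff_fg.mpr hW
  refine Submodule.finiteDimensional_of_le (S₂ := W) ?_
  rintro _ ⟨f, rfl⟩
  exact h f

theorem IsJordanCoalgebra.tripleReversal (hJ : IsJordanCoalgebra Δ) (h2 : (2 : k) ≠ 0) :
    TripleReversal (lactHom Δ) (fun f g => dualMul Δ f g) := by
  intro x y z v
  refine eq_of_forall_dual (k := k) fun g => ?_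
  simp only [map_add, map_sub, lactHom_apply, apply_lact]
  -- The actions are transposes of right multiplications. The test functional `g` takes one of the
  -- three symmetric slots, so commutativity turns the terms into iterated right multiplications of
  -- `g`.
  have h := LinearMap.congr_fun (hJ.linearized h2 x z g y) v
  have hc := hJ.comm
  simp only [LinearMap.add_apply, LinearMap.sub_apply, LinearMap.zero_apply] at h
  rw [hc (dualMul Δ x y), hc (dualMul Δ z y), hc x (dualMul Δ y _), hc z (dualMul Δ y _),
    hc y (dualMul Δ z g), hc y (dualMul Δ x g), hc z g, hc x g, hc g (dualMul Δ y _),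
    hc y (dualMul Δ x z), hc z y, hc (dualMul Δ (dualMul Δ x z) y) g] at h
  linear_combination -h

/-- Jordan coalgebras are locally finite-dimensional. -/
theorem IsJordanCoalgebra.exists_subcoalgebra (hJ : IsJordanCoalgebra Δ) (h2 : (2 : k) ≠ 0)
    (a : A) : ∃ B : Submodule k A, FiniteDimensional k B ∧ IsSubcoalgebra Δ B ∧ a ∈ B := by
  obtain ⟨B, hB, ha, h⟩ := (hJ.tripleReversal h2).exists_stable h2
    (fun v => finiteDimensional_range_lactHom_flip v) a
  refine ⟨B, hB, isSubcoalgebra_of_stable h fun f b hb => ?_, ha⟩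
  have : ract Δ f b = lact Δ f b := eq_of_forall_dual (k := k) fun g => by
    rw [apply_ract, apply_lact, hJ.comm]
  rw [this]
  exact h f b hb

end Coalgebra

/-! ### Separating `g'` from `d` by evaluation at the unity -/

section Algebra

variable {k V : Type*} [Field k] [AddCommGroup V] [Module k V]

/-- `opBracket` as a bilinear map. -/
def opBracketHom (m : V →ₗ[k] V →ₗ[k] V) : V →ₗ[k] V →ₗ[k] Module.End k V :=
  LinearMap.mk₂ k (opBracket m)
    (fun a a' b => by ext x; simp; abel)
    (fun c a b => by ext x; simp [smul_sub])
    (fun a b b' => by ext x; simp; abel)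
    (fun c a b => by ext x; simp [smul_sub])

@[simp] theorem opBracketHom_apply (m : V →ₗ[k] V →ₗ[k] V) (a b : V) :
    opBracketHom m a b = opBracket m a b := rfl

/-- The operator `u - (eu)'`; it is the derivation `d` if `u = f' + d` and `e` is a unity. -/
def derPart (m : V →ₗ[k] V →ₗ[k] V) (e : V) : Module.End k V →ₗ[k] Module.End k V :=
  LinearMap.id - rmul m ∘ₗ LinearMap.applyₗ e

theorem derPart_apply (m : V →ₗ[k] V →ₗ[k] V) (e : V) (u : Module.End k V) :
    derPart m e u = u - rmul m (u e) := rfl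

theorem rmul_add_apply_unity {m : V →ₗ[k] V →ₗ[k] V} {e : V} (he : IsUnity m e) (g : V)
    {d : Module.End k V} (hd : IsDer m d) : (rmul m g + d) e = g := by
  rw [LinearMap.add_apply, hd.apply_unity he, add_zero, rmul_apply, (he g).1]

theorem derPart_rmul_add {m : V →ₗ[k] V →ₗ[k] V} {e : V} (he : IsUnity m e) (g : V)
    {d : Module.End k V} (hd : IsDer m d) : derPart m e (rmul m g + d) = d := by
  rw [derPart_apply, rmul_add_apply_unity he g hd, add_sub_cancel_left]

end Algebra

/-! ### The canonical pairing and its perfectness -/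

section Coalgebra

variable {k A : Type*} [Field k] [AddCommGroup A] [Module k A] {Δ : A →ₗ[k] A ⊗[k] A}

theorem ract_zero : ract Δ 0 = 0 := by
  ext a
  simp [ract]

theorem nullMul_apply (x y : Module.Dual k A × A) :
    nullMul Δ x y = (dualMul Δ x.1 y.1, lact Δ x.1 y.2 + ract Δ y.1 x.2) := rfl

theorem prime_apply (b : A) (x : Module.Dual k A × A) :
    prime Δ b x = (0, lact Δ x.1 b) := by
  change nullMul Δ x (0, b) = _
  simp [nullMul_apply, ract_zero]

theorem mixed_apply (p : Module.Dual k A) (q : A) (x : Module.Dual k A × A) :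
    mixed Δ p q x = (0, lact Δ (dualMul Δ x.1 p) q - ract Δ p (lact Δ x.1 q)) := by
  simp [mixed, nullMul_apply, ract_zero]

/-- `mixed` as a bilinear map. -/
noncomputable def mixedHom (Δ : A →ₗ[k] A ⊗[k] A) :
    Module.Dual k A →ₗ[k] A →ₗ[k] Module.End k (Module.Dual k A × A) :=
  (opBracketHom (nullMul Δ)).compl₁₂ (LinearMap.inl k _ A) (LinearMap.inr k _ A)

@[simp] theorem mixedHom_apply (p : Module.Dual k A) (q : A) :
    mixedHom Δ p q = mixed Δ p q := rfl

/-- The duality on which the pairing rests: matrix coefficients of `[p, q]` are values of the inner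
derivation `[f, g]`. -/
theorem apply_mixed (hJ : IsJordanCoalgebra Δ) (f g p : Module.Dual k A) (q : A) (a : A) :
    g (mixed Δ p q (f, a)).2 = opBracket (dualMul Δ) f g p q := by
  rw [mixed_apply, map_sub, apply_lact, apply_ract, apply_lact, opBracket_apply,
    LinearMap.sub_apply, hJ.comm g, hJ.comm f p]

theorem coOpPiece_eq (B : Submodule k A) :
    coOpPiece Δ B = B.map (prime Δ) ⊔ Submodule.map₂ (mixedHom Δ) ⊤ B := by
  rw [coOpPiece, Submodule.map₂_eq_span_image2]
  congr 2
  ext u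
  simp only [Set.mem_ofPred_eq, Set.mem_image2, mixedHom_apply]
  exact ⟨fun ⟨f, b, hb, h⟩ => ⟨f, trivial, b, hb, h.symm⟩,
    fun ⟨f, _, b, hb, h⟩ => ⟨f, b, hb, h.symm⟩⟩

theorem coOpPiece_mono : Monotone (coOpPiece Δ) := by
  intro B B' h
  rw [coOpPiece_eq, coOpPiece_eq]
  exact sup_le_sup (Submodule.map_mono h) (Submodule.map₂_le_map₂_right h)

theorem coOpPiece_le (B : Submodule k A) : coOpPiece Δ B ≤ coOpSpace Δ :=
  coOpPiece_mono le_top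

theorem prime_mem_coOpPiece {B : Submodule k A} {b : A} (hb : b ∈ B) :
    prime Δ b ∈ coOpPiece Δ B :=
  Submodule.mem_sup_left ⟨b, hb, rfl⟩

theorem mixed_mem_coOpPiece {B : Submodule k A} (p : Module.Dual k A) {b : A} (hb : b ∈ B) :
    mixed Δ p b ∈ coOpPiece Δ B :=
  Submodule.mem_sup_right (Submodule.subset_span ⟨p, b, hb, rfl⟩)

/-- By duality, since inner derivations preserve the annihilator of `B`. Hence `[p, q]` depends only
on the restriction of `p` to `B`, which makes `[A*, B]` finite-dimensional for finite-dimensional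
`B`. -/
theorem mixed_eq_zero {B : Submodule k A} (hJ : IsJordanCoalgebra Δ) (hs : IsSubcoalgebra Δ B)
    {p : Module.Dual k A} (hp : ∀ b ∈ B, p b = 0) {q : A} (hq : q ∈ B) : mixed Δ p q = 0 := by
  refine LinearMap.ext fun x => Prod.ext (by rw [mixed_apply]; rfl) ?_
  refine eq_of_forall_dual (k := k) fun g => ?_
  obtain ⟨f, a⟩ := x
  rw [apply_mixed hJ, hs.intDer_apply_eq_zero (opBracket_mem_intDer _ f g) hp q hq]
  simp

theorem fg_map₂_mixedHom {B : Submodule k A} (hJ : IsJordanCoalgebra Δ)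
    (hs : IsSubcoalgebra Δ B) [FiniteDimensional k B] :
    (Submodule.map₂ (mixedHom Δ) ⊤ B).FG := by
  obtain ⟨π, hπ⟩ := exists_projection B
  have hfg : (Submodule.map₂ (mixedHom Δ) (LinearMap.range π.dualMap) B).FG :=
    Submodule.FG.map₂ _ (Module.Finite.iff_fg.mp inferInstance)
      (Module.Finite.iff_fg.mp inferInstance)
  have : FiniteDimensional k (Submodule.map₂ (mixedHom Δ) (LinearMap.range π.dualMap) B) :=
    Module.Finite.iff_fg.mpr hfg
  refine Module.Finite.iff_fg.mp (Submodule.finiteDimensional_of_le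
    (S₂ := Submodule.map₂ (mixedHom Δ) (LinearMap.range π.dualMap) B) ?_)
  refine Submodule.map₂_le.mpr fun f _ b hb => ?_
  have h : mixed Δ (f - π.dualMap (f ∘ₗ B.subtype)) b = 0 := by
    refine mixed_eq_zero hJ hs (fun x hx => ?_) hb
    have := hπ ⟨x, hx⟩
    simp only at this
    simp [LinearMap.dualMap_apply', this]
  rw [← mixedHom_apply, map_sub, LinearMap.sub_apply, sub_eq_zero] at h
  rw [h]
  exact Submodule.apply_mem_map₂ _ ⟨_, rfl⟩ hb

theorem finiteDimensional_piece {B : Submodule k A} (hJ : IsJordanCoalgebra Δ)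
    (hs : IsSubcoalgebra Δ B) [hB : FiniteDimensional k B] : FiniteDimensional k (piece Δ B) := by
  have h1 : (coOpPiece Δ B).FG := by
    rw [coOpPiece_eq]
    exact ((Module.Finite.iff_fg.mp hB).map _).sup (fg_map₂_mixedHom hJ hs)
  have h2 : FiniteDimensional k (coOpPiece Δ B) := Module.Finite.iff_fg.mpr h1
  have h3 : FiniteDimensional k ((coOpPiece Δ B).submoduleOf (coOpSpace Δ)) :=
    Module.Finite.equiv (Submodule.submoduleOfEquivOfLe (coOpPiece_le B)).symm
  have hB' := Module.Finite.iff_fg.mp hB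
  exact Module.Finite.iff_fg.mpr (hB'.prod ((Module.Finite.iff_fg.mp h3).prod hB'))

/-- The linear map `(b, ∑ pᵢ ⊗ qᵢ) ↦ b' + ∑ [pᵢ, qᵢ]`. -/
noncomputable def coOpMap (Δ : A →ₗ[k] A ⊗[k] A) :
    A × (Module.Dual k A ⊗[k] A) →ₗ[k] Module.End k (Module.Dual k A × A) :=
  (prime Δ).coprod (TensorProduct.lift (mixedHom Δ))

theorem coOpMap_apply (z : A × (Module.Dual k A ⊗[k] A)) :
    coOpMap Δ z = prime Δ z.1 + TensorProduct.lift (mixedHom Δ) z.2 := rfl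

theorem range_coOpMap : LinearMap.range (coOpMap Δ) = coOpSpace Δ := by
  rw [coOpMap, LinearMap.range_coprod, coOpSpace, coOpPiece_eq, Submodule.map_top]
  congr 1
  refine le_antisymm ?_ (Submodule.map₂_le.mpr fun f _ b _ => ⟨f ⊗ₜ b, by simp⟩)
  rintro _ ⟨t, rfl⟩
  induction t with
  | zero => simp
  | tmul f b => exact Submodule.apply_mem_map₂ _ trivial trivial
  | add x y hx hy => rw [map_add]; exact add_mem hx hy

theorem lift_mixedHom_apply (t : Module.Dual k A ⊗[k] A) (hJ : IsJordanCoalgebra Δ)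
    (f g : Module.Dual k A) (a : A) : g (TensorProduct.lift (mixedHom Δ) t (f, a)).2 =
      TensorProduct.lift (opBracket (dualMul Δ) f g) t := by
  induction t with
  | zero => simp
  | tmul p q => simp only [TensorProduct.lift.tmul, mixedHom_apply, apply_mixed hJ]
  | add x y hx hy =>
    rw [map_add, map_add, LinearMap.add_apply, Prod.snd_add, map_add, hx, hy]

/-- The functional `∑ pᵢ ⊗ qᵢ ↦ ∑ ⟨pᵢd, qᵢ⟩`, as a linear function of `d`. -/
noncomputable def endPairing (k A : Type*) [Field k] [AddCommGroup A] [Module k A] :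
    Module.End k (Module.Dual k A) →ₗ[k] Module.Dual k (Module.Dual k A ⊗[k] A) where
  toFun d := TensorProduct.lift d
  map_add' d d' := TensorProduct.ext' fun p q => by simp
  map_smul' c d := TensorProduct.ext' fun p q => by simp

@[simp] theorem endPairing_tmul (d : Module.End k (Module.Dual k A)) (p : Module.Dual k A)
    (q : A) : endPairing k A d (p ⊗ₜ q) = d p q := rfl

theorem endPairing_congr_of_subcoalgebra (hJ : IsJordanCoalgebra Δ) (h2 : (2 : k) ≠ 0)
    (t : Module.Dual k A ⊗[k] A) :
    ∃ B : Submodule k A, FiniteDimensional k B ∧ IsSubcoalgebra Δ B ∧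
      ∀ d d' : Module.End k (Module.Dual k A), (∀ f, ∀ b ∈ B, d f b = d' f b) →
        endPairing k A d t = endPairing k A d' t := by
  induction t with
  | zero =>
    obtain ⟨B, hB, hs, -⟩ := hJ.exists_subcoalgebra h2 0
    exact ⟨B, hB, hs, fun d d' _ => by simp⟩
  | tmul p q =>
    obtain ⟨B, hB, hs, hq⟩ := hJ.exists_subcoalgebra h2 q
    exact ⟨B, hB, hs, fun d d' h => h p q hq⟩
  | add x y hx hy =>
    obtain ⟨B, hB, hs, h⟩ := hx
    obtain ⟨B', hB', hs', h'⟩ := hy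
    refine ⟨B ⊔ B', inferInstance, hs.sup hs', fun d d' hd => ?_⟩
    rw [map_add, map_add, h d d' fun f b hb => hd f b (Submodule.mem_sup_left hb),
      h' d d' fun f b hb => hd f b (Submodule.mem_sup_right hb)]

/-- Well-definedness on `[A*, A]`: the tensor involves only finitely many elements of `A`, so `d`
may be replaced by an inner derivation, for which the value is a sum of matrix coefficients of the
zero operator. -/
theorem endPairing_eq_zero (hJ : IsJordanCoalgebra Δ) (h2 : (2 : k) ≠ 0)
    {d : Module.End k (Module.Dual k A)} (hd : d ∈ wIntDer Δ) {t : Module.Dual k A ⊗[k] A}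
    (ht : TensorProduct.lift (mixedHom Δ) t = 0) : endPairing k A d t = 0 := by
  obtain ⟨B, hB, hs, h⟩ := endPairing_congr_of_subcoalgebra hJ h2 t
  obtain ⟨i, hi, hid⟩ := hd.2 B hB hs
  rw [h d i hid]
  clear h hid
  induction hi using Submodule.span_induction with
  | mem u hu =>
    obtain ⟨f, -, g, -, rfl⟩ := hu
    change TensorProduct.lift (opBracket (dualMul Δ) f g) t = 0
    rw [← lift_mixedHom_apply t hJ f g 0, ht]
    simp
  | zero => simp
  | add u v _ _ hu hv => rw [map_add, LinearMap.add_apply, hu, hv, add_zero]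
  | smul c u _ hu => rw [map_smul, LinearMap.smul_apply, hu, smul_zero]

theorem lact_unity {e : Module.Dual k A} (he : IsUnity (dualMul Δ) e) (b : A) :
    lact Δ e b = b :=
  eq_of_forall_dual (k := k) fun g => by rw [apply_lact, (he g).2]

/-- Since `[e, g] = 0`, the operators `[p, q]` kill the unity; so `A' + [A*, A]` is a direct sum and
`b ↦ b'` is injective. -/
theorem coOpMap_apply_unity (hJ : IsJordanCoalgebra Δ) {e : Module.Dual k A}
    (he : IsUnity (dualMul Δ) e) (z : A × (Module.Dual k A ⊗[k] A)) :
    (coOpMap Δ z (e, 0)).2 = z.1 := by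
  have h : ∀ t, (TensorProduct.lift (mixedHom Δ) t (e, 0)).2 = 0 := by
    intro t
    refine eq_of_forall_dual (k := k) fun g => ?_
    rw [lift_mixedHom_apply t hJ, map_zero]
    have : opBracket (dualMul Δ) e g = 0 := by
      ext1 x
      rw [opBracket_apply, (he x).2, (he _).2, sub_self, LinearMap.zero_apply]
    rw [this]
    exact LinearMap.congr_fun (map_zero (endPairing k A)) t
  rw [coOpMap_apply, LinearMap.add_apply, Prod.snd_add, h, add_zero, prime_apply, lact_unity he]

/-- The functional `(b, ∑ pᵢ ⊗ qᵢ) ↦ ⟨g, b⟩ + ∑ ⟨pᵢd, qᵢ⟩`, where `g = eu` and `d = u - g'`, as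
a linear function of `u`. -/
noncomputable def prePairing (Δ : A →ₗ[k] A ⊗[k] A) (e : Module.Dual k A) :
    Module.End k (Module.Dual k A) →ₗ[k] Module.Dual k (A × (Module.Dual k A ⊗[k] A)) where
  toFun u := LinearMap.coprod (u e) (endPairing k A (derPart (dualMul Δ) e u))
  map_add' u v := by
    refine LinearMap.ext fun z => ?_
    simp only [LinearMap.coprod_apply, map_add, LinearMap.add_apply]
    abel
  map_smul' c u := by
    refine LinearMap.ext fun z => ?_
    simp only [LinearMap.coprod_apply, map_smul, LinearMap.smul_apply, RingHom.id_apply, smul_add]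

theorem prePairing_apply (e : Module.Dual k A) (u : Module.End k (Module.Dual k A))
    (z : A × (Module.Dual k A ⊗[k] A)) : prePairing Δ e u z =
      u e z.1 + endPairing k A (derPart (dualMul Δ) e u) z.2 := rfl

theorem derPart_mem_wIntDer {e : Module.Dual k A} (he : IsUnity (dualMul Δ) e)
    {u : Module.End k (Module.Dual k A)} (hu : u ∈ opSpace Δ) :
    derPart (dualMul Δ) e u ∈ wIntDer Δ := by
  obtain ⟨_, ⟨g, rfl⟩, d, hd, rfl⟩ := Submodule.mem_sup.mp hu
  rwa [derPart_rmul_add he g hd.1]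

theorem prePairing_eq_zero (hJ : IsJordanCoalgebra Δ) (h2 : (2 : k) ≠ 0) {e : Module.Dual k A}
    (he : IsUnity (dualMul Δ) e) {u : Module.End k (Module.Dual k A)} (hu : u ∈ opSpace Δ)
    {z : A × (Module.Dual k A ⊗[k] A)} (hz : coOpMap Δ z = 0) : prePairing Δ e u z = 0 := by
  have h1 : z.1 = 0 := by
    rw [← coOpMap_apply_unity hJ he z, hz]
    rfl
  rw [coOpMap_apply, h1, map_zero, zero_add] at hz
  rw [prePairing_apply, h1, map_zero, zero_add]
  exact endPairing_eq_zero hJ h2 (derPart_mem_wIntDer he hu) hz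

theorem exists_opPairing (hJ : IsJordanCoalgebra Δ) (h2 : (2 : k) ≠ 0) {e : Module.Dual k A}
    (he : IsUnity (dualMul Δ) e) :
    ∃ R : opSpace Δ →ₗ[k] Module.Dual k (coOpSpace Δ),
      ∀ (u : opSpace Δ) (w : coOpSpace Δ) (z : A × (Module.Dual k A ⊗[k] A)),
        w.1 = coOpMap Δ z → R u w = prePairing Δ e u.1 z := by
  obtain ⟨s, hs⟩ := exists_section (coOpMap Δ)
  let c : coOpSpace Δ →ₗ[k] LinearMap.range (coOpMap Δ) :=
    Submodule.inclusion range_coOpMap.ge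
  -- The choice of section is immaterial, because `prePairing` vanishes on the kernel of `coOpMap`.
  refine ⟨(s ∘ₗ c).dualMap ∘ₗ prePairing Δ e ∘ₗ (opSpace Δ).subtype, fun u w z hw => ?_⟩
  change prePairing Δ e u.1 (s (c w)) = _
  rw [← sub_eq_zero, ← map_sub]
  refine prePairing_eq_zero hJ h2 he u.2 ?_
  have h1 : coOpMap Δ (s (c w)) = w.1 := hs (c w)
  rw [map_sub, h1, hw, sub_self]

/-- A functional on the operators `[p, b]`, `b ∈ B`, is induced by an inner derivation. -/
theorem exists_intDer_eq (hJ : IsJordanCoalgebra Δ)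
    (φ : Module.Dual k (coOpSpace Δ)) (B : Submodule k A) [FiniteDimensional k B]
    (hs : IsSubcoalgebra Δ B) :
    ∃ i ∈ intDer (dualMul Δ), ∀ (p : Module.Dual k A) (b : A), b ∈ B →
      ∀ w : coOpSpace Δ, w.1 = mixed Δ p b → φ w = i p b := by
  let S := Submodule.map₂ (mixedHom Δ) ⊤ B
  have hS : FiniteDimensional k S := Module.Finite.iff_fg.mpr (fg_map₂_mixedHom hJ hs)
  have hSle : S ≤ coOpSpace Δ := by
    refine le_trans ?_ (coOpPiece_le B)
    rw [coOpPiece_eq]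
    exact le_sup_right
  -- `J` records the matrix coefficients `⟨g, fw⟩`.
  let J : S →ₗ[k] Module.Dual k (Module.Dual k A ⊗[k] Module.Dual k A) :=
    { toFun := fun w => TensorProduct.lift
        ((LinearMap.llcomp k (Module.Dual k A) A k).flip
          (LinearMap.snd k _ _ ∘ₗ w.1 ∘ₗ LinearMap.inl k _ _)).flip
      map_add' := fun w w' => TensorProduct.ext' fun f g => by simp
      map_smul' := fun c w => TensorProduct.ext' fun f g => by simp }
  have hJt : ∀ (w : S) (f g : Module.Dual k A), J w (f ⊗ₜ g) = g (w.1 (f, 0)).2 :=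
    fun w f g => rfl
  have hinj : Function.Injective J := by
    refine (injective_iff_map_eq_zero J).mpr fun w hw => Subtype.ext ?_
    -- Operators in `S` ignore the `A`-component and take values in `A`, so matrix coefficients
    -- determine them.
    have hmem : ∀ v ∈ S, ∀ (f : Module.Dual k A) (a : A),
        v (f, a) = (0, (v (f, 0)).2) := by
      intro v hv f a
      have hle : S ≤ LinearMap.ker (LinearMap.mk₂ k
        (fun (v : Module.End k (Module.Dual k A × A)) (x : Module.Dual k A × A) =>
          v x - ((0 : Module.Dual k A), (v (x.1, 0)).2))
        (fun v v' x => by ext1 <;> simp; abel) (fun c v x => by ext1 <;> simp [smul_sub])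
        (fun v x x' => by
          have : ((x + x').1, (0 : A)) = (x.1, 0) + (x'.1, 0) := by simp
          rw [this, map_add, map_add]
          ext1 <;> simp; abel)
        (fun c v x => by
          have : ((c • x).1, (0 : A)) = c • (x.1, (0 : A)) := by simp
          rw [this, map_smul, map_smul]
          ext1 <;> simp [smul_sub])) := by
        refine Submodule.map₂_le.mpr fun p _ b _ => ?_
        refine LinearMap.mem_ker.mpr (LinearMap.ext fun x => ?_)
        simp [mixed_apply]
      have := LinearMap.congr_fun (LinearMap.mem_ker.mp (hle hv)) (f, a)
      simpa [sub_eq_zero] using this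
    refine LinearMap.ext fun x => ?_
    obtain ⟨f, a⟩ := x
    rw [hmem w.1 w.2]
    refine Prod.ext rfl (eq_of_forall_dual (k := k) fun g => ?_)
    rw [← hJt, hw]
    simp
  -- As `S` is finite-dimensional, injectivity of `J` makes every functional on `S` a combination
  -- `t` of matrix coefficients; replacing each `f ⊗ g` in `t` by `[f, g]` gives the inner
  -- derivation.
  obtain ⟨t, ht⟩ := LinearMap.flip_surjective_iff₁.mpr hinj (φ ∘ₗ Submodule.inclusion hSle)
  have hK : ∀ s : Module.Dual k A ⊗[k] Module.Dual k A,
      TensorProduct.lift (opBracketHom (dualMul Δ)) s ∈ intDer (dualMul Δ) ∧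
      ∀ (p : Module.Dual k A) (b : A) (w : S), w.1 = mixed Δ p b →
        J w s = TensorProduct.lift (opBracketHom (dualMul Δ)) s p b := by
    intro s
    induction s with
    | zero => exact ⟨by simp, fun _ _ _ _ => by simp⟩
    | tmul f g =>
      refine ⟨opBracket_mem_intDer _ f g, fun p b w hw => ?_⟩
      rw [hJt, hw, apply_mixed hJ]
      rfl
    | add x y hx hy =>
      rw [map_add]
      refine ⟨add_mem hx.1 hy.1, fun p b w hw => ?_⟩
      rw [map_add, hx.2 p b w hw, hy.2 p b w hw]
      rfl
  refine ⟨_, (hK t).1, fun p b hb w hw => ?_⟩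
  have hwS : w.1 ∈ S := hw ▸ Submodule.apply_mem_map₂ (mixedHom Δ) trivial hb
  rw [← (hK t).2 p b ⟨w.1, hwS⟩ hw]
  exact (LinearMap.congr_fun ht ⟨w.1, hwS⟩).symm

theorem exists_wIntDer_eq (hJ : IsJordanCoalgebra Δ) (h2 : (2 : k) ≠ 0)
    (φ : Module.Dual k (coOpSpace Δ)) :
    ∃ d ∈ wIntDer Δ, ∀ (p : Module.Dual k A) (b : A) (w : coOpSpace Δ),
      w.1 = mixed Δ p b → φ w = d p b := by
  have hmem : ∀ (p : Module.Dual k A) (b : A), mixed Δ p b ∈ coOpSpace Δ :=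
    fun p b => mixed_mem_coOpPiece p trivial
  let d : Module.End k (Module.Dual k A) :=
    LinearMap.mk₂ k (fun (p : Module.Dual k A) (b : A) => φ ⟨mixed Δ p b, hmem p b⟩)
      (fun p p' b => by
        rw [← map_add]
        exact congrArg φ (Subtype.ext (LinearMap.congr_fun (map_add (mixedHom Δ) p p') b)))
      (fun c p b => by
        rw [← map_smul]
        exact congrArg φ (Subtype.ext (LinearMap.congr_fun (map_smul (mixedHom Δ) c p) b)))
      (fun p b b' => by
        rw [← map_add]
        exact congrArg φ (Subtype.ext (map_add (mixedHom Δ p) b b')))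
      (fun c p b => by
        rw [← map_smul]
        exact congrArg φ (Subtype.ext (map_smul (mixedHom Δ p) c b)))
  have hd : ∀ (p : Module.Dual k A) (b : A), d p b = φ ⟨mixed Δ p b, hmem p b⟩ :=
    fun _ _ => rfl
  have hloc : ∀ B : Submodule k A, FiniteDimensional k B → IsSubcoalgebra Δ B →
      ∃ i ∈ intDer (dualMul Δ), ∀ f : Module.Dual k A, ∀ b ∈ B, d f b = i f b := by
    intro B hB hs
    obtain ⟨i, hi, h⟩ := exists_intDer_eq hJ φ B hs
    exact ⟨i, hi, fun f b hb => h f b hb _ rfl⟩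
  -- The derivation law is tested at one `a` at a time, inside a finite-dimensional subcoalgebra
  -- where `d` agrees with an inner derivation.
  refine ⟨d, ⟨fun f g => LinearMap.ext fun a => ?_, hloc⟩, fun p b w hw => ?_⟩
  · obtain ⟨B, hB, hs, ha⟩ := hJ.exists_subcoalgebra h2 a
    obtain ⟨i, hi, h⟩ := hloc B hB hs
    have hder := LinearMap.congr_fun (IsJordanMul.isDer_of_mem hJ h2 hi f g) a
    have h1 := hs.dualMul_eq_zero (f := f) (g := d g - i g)
      (.inr fun b hb => by rw [LinearMap.sub_apply, h g b hb, sub_self]) a ha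
    have h3 := hs.dualMul_eq_zero (f := g) (g := d f - i f)
      (.inr fun b hb => by rw [LinearMap.sub_apply, h f b hb, sub_self]) a ha
    rw [map_sub, LinearMap.sub_apply, sub_eq_zero] at h1 h3
    rw [h _ a ha, hder, LinearMap.add_apply, LinearMap.add_apply, h1, h3]
  · rw [hd]
    exact congrArg φ (Subtype.ext hw)

theorem exists_opPairing_equiv (hJ : IsJordanCoalgebra Δ) (h2 : (2 : k) ≠ 0)
    {e : Module.Dual k A} (he : IsUnity (dualMul Δ) e) :
    ∃ R : opSpace Δ ≃ₗ[k] Module.Dual k (coOpSpace Δ),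
      ∀ (u : opSpace Δ) (w : coOpSpace Δ) (z : A × (Module.Dual k A ⊗[k] A)),
        w.1 = coOpMap Δ z → R u w = prePairing Δ e u.1 z := by
  obtain ⟨R, hR⟩ := exists_opPairing hJ h2 he
  have hprime : ∀ (u : opSpace Δ) (b : A) (w : coOpSpace Δ), w.1 = prime Δ b →
      R u w = u.1 e b := by
    intro u b w hw
    rw [hR u w (b, 0) (by rw [coOpMap_apply, hw]; simp), prePairing_apply]
    simp
  have hmixed : ∀ (u : opSpace Δ) (p : Module.Dual k A) (q : A) (w : coOpSpace Δ),
      w.1 = mixed Δ p q → R u w = derPart (dualMul Δ) e u.1 p q := by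
    intro u p q w hw
    rw [hR u w (0, p ⊗ₜ q) (by rw [coOpMap_apply, hw]; simp), prePairing_apply]
    simp
  have hp : ∀ b, prime Δ b ∈ coOpSpace Δ := fun b => prime_mem_coOpPiece trivial
  have hm : ∀ (p : Module.Dual k A) (b : A), mixed Δ p b ∈ coOpSpace Δ :=
    fun p b => mixed_mem_coOpPiece p trivial
  refine ⟨LinearEquiv.ofBijective R ⟨?_, fun φ => ?_⟩, hR⟩
  · refine (injective_iff_map_eq_zero R).mpr fun u hu => Subtype.ext ?_
    have h1 : u.1 e = 0 := LinearMap.ext fun b => by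
      rw [← hprime u b ⟨_, hp b⟩ rfl, hu]
      rfl
    have h3 : derPart (dualMul Δ) e u.1 = 0 := LinearMap.ext fun p => LinearMap.ext fun q => by
      rw [← hmixed u p q ⟨_, hm p q⟩ rfl, hu]
      rfl
    rw [derPart_apply, h1, map_zero, sub_zero] at h3
    exact h3
  · obtain ⟨d, hd, hφ⟩ := exists_wIntDer_eq hJ h2 φ
    let g : Module.Dual k A := φ ∘ₗ (prime Δ).codRestrict (coOpSpace Δ) hp
    let u : opSpace Δ := ⟨rmul (dualMul Δ) g + d,
      add_mem (rmul_mem_opSpace Δ g) (Submodule.mem_sup_right hd)⟩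
    refine ⟨u, LinearMap.ext fun w => ?_⟩
    obtain ⟨z, hz⟩ : w.1 ∈ LinearMap.range (coOpMap Δ) := range_coOpMap.ge w.2
    have key : ∀ (z : A × (Module.Dual k A ⊗[k] A)),
        φ ⟨coOpMap Δ z, range_coOpMap.le ⟨z, rfl⟩⟩ = prePairing Δ e u.1 z := by
      have : φ ∘ₗ (coOpMap Δ).codRestrict (coOpSpace Δ) (fun z => range_coOpMap.le ⟨z, rfl⟩) =
          prePairing Δ e u.1 := by
        refine LinearMap.prod_ext (LinearMap.ext fun b => ?_) (TensorProduct.ext' fun p q => ?_)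
        · have e1 : coOpMap Δ (b, 0) = prime Δ b := by simp [coOpMap_apply]
          change φ _ = u.1 e b + endPairing k A (derPart (dualMul Δ) e u.1) 0
          rw [map_zero, add_zero, rmul_add_apply_unity he g hd.1]
          exact congrArg φ (Subtype.ext e1)
        · have e1 : coOpMap Δ (0, p ⊗ₜ q) = mixed Δ p q := by simp [coOpMap_apply]
          change φ _ = u.1 e (0 : A) + endPairing k A (derPart (dualMul Δ) e u.1) (p ⊗ₜ q)
          rw [map_zero, zero_add, derPart_rmul_add he g hd.1]
          exact hφ p q _ e1
      exact fun z => LinearMap.congr_fun this z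
    rw [hR u w z hz.symm, ← key]
    exact congrArg φ (Subtype.ext hz)

theorem exists_pairing (hJ : IsJordanCoalgebra Δ) (h2 : (2 : k) ≠ 0)
    {e : Module.Dual k A} (he : IsUnity (dualMul Δ) e) :
    ∃ Φ : KKTAlg Δ ≃ₗ[k] Module.Dual k (KKTCoalg Δ),
      ∀ (x : KKTAlg Δ) (l : KKTCoalg Δ) (z : A × (Module.Dual k A ⊗[k] A)),
        l.2.1.1 = coOpMap Δ z →
          Φ x l = x.1 l.1 + prePairing Δ e x.2.1.1 z + x.2.2 l.2.2 := by
  obtain ⟨R, hR⟩ := exists_opPairing_equiv hJ h2 he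
  refine ⟨((LinearEquiv.refl k _).prodCongr ((R.prodCongr (LinearEquiv.refl k _)).trans
    (Module.dualProdDualEquivDual k _ _))).trans (Module.dualProdDualEquivDual k _ _),
    fun x l z hz => ?_⟩
  rw [← hR x.2.1 l.2.1 z hz, add_assoc]
  rfl

theorem isCanonicalPairing_of_prePairing {e : Module.Dual k A} (he : IsUnity (dualMul Δ) e)
    {Φ : KKTAlg Δ →ₗ[k] Module.Dual k (KKTCoalg Δ)}
    (hΦ : ∀ (x : KKTAlg Δ) (l : KKTCoalg Δ) (z : A × (Module.Dual k A ⊗[k] A)),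
      l.2.1.1 = coOpMap Δ z →
        Φ x l = x.1 l.1 + prePairing Δ e x.2.1.1 z + x.2.2 l.2.2) : IsCanonicalPairing Δ Φ := by
  intro x l g d b n p q hd hx hl
  rw [hΦ x l (b, ∑ i, p i ⊗ₜ q i) (by simp [hl, coOpMap_apply]), prePairing_apply, hx,
    rmul_add_apply_unity he g hd.1, derPart_rmul_add he g hd.1, map_sum]
  simp only [endPairing_tmul]
  ring

end Coalgebra

/-! ### Operator identities behind the Kantor-Koecher-Tits construction -/

section Algebra

variable {k V : Type*} [Field k] [AddCommGroup V] [Module k V]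

/-- `f ∇ h = (fh)' - [f, h]`, as a bilinear map with values in operators. -/
def nablaHom (m : V →ₗ[k] V →ₗ[k] V) : V →ₗ[k] V →ₗ[k] Module.End k V :=
  m.compr₂ (rmul m) - opBracketHom m

theorem nablaHom_apply (m : V →ₗ[k] V →ₗ[k] V) (f h : V) :
    nablaHom m f h = rmul m (m f h) - opBracket m f h := rfl

/-- The map `ε : f' + d ↦ -f' + d`. -/
def epsHom (m : V →ₗ[k] V →ₗ[k] V) (e : V) : Module.End k V →ₗ[k] Module.End k V :=
  LinearMap.id - (2 : k) • (rmul m ∘ₗ LinearMap.applyₗ e)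

theorem epsHom_apply (m : V →ₗ[k] V →ₗ[k] V) (e : V) (u : Module.End k V) :
    epsHom m e u = u - (2 : k) • rmul m (u e) := rfl

theorem epsHom_rmul_add {m : V →ₗ[k] V →ₗ[k] V} {e : V} (he : IsUnity m e) (g : V)
    {d : Module.End k V} (hd : IsDer m d) : epsHom m e (rmul m g + d) = d - rmul m g := by
  rw [epsHom_apply, rmul_add_apply_unity he g hd]
  module

theorem rcomm_jacobi (u v w : Module.End k V) :
    rcomm (rcomm u v) w + rcomm (rcomm v w) u + rcomm (rcomm w u) v = 0 := by
  ext x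
  simp only [rcomm_apply, map_sub, LinearMap.add_apply, LinearMap.zero_apply]
  abel

theorem rcomm_sub_left (u v w : Module.End k V) :
    rcomm (u - v) w = rcomm u w - rcomm v w := by
  ext x
  simp only [rcomm_apply, LinearMap.sub_apply, map_sub]
  abel

theorem rcomm_sub_right (u v w : Module.End k V) :
    rcomm u (v - w) = rcomm u v - rcomm u w := by
  ext x
  simp only [rcomm_apply, LinearMap.sub_apply, map_sub]
  abel

/-- An operator of the form `g' + d` with a derivation `d`. -/
def IsRmulAddDer (m : V →ₗ[k] V →ₗ[k] V) (u : Module.End k V) : Prop :=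
  ∃ g d, IsDer m d ∧ u = rmul m g + d

variable {m : V →ₗ[k] V →ₗ[k] V} {e : V}

/-- Both sides are the Jordan triple product `x(fh') + f(xh') - (xf)h'`, symmetric in its outer
arguments `f` and `x`. -/
theorem IsJordanMul.nablaHom_apply_comm (h : IsJordanMul m) (f h' x : V) :
    nablaHom m f h' x = nablaHom m x h' f := by
  simp only [nablaHom_apply, LinearMap.sub_apply, rmul_apply, opBracket_apply]
  rw [h.comm x (m f h'), h.comm f x, h.comm (m x h') f]
  abel

theorem IsJordanMul.epsHom_nablaHom (h : IsJordanMul m) (h2 : (2 : k) ≠ 0) (he : IsUnity m e)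
    (f h' : V) : epsHom m e (nablaHom m f h') = -rmul m (m f h') - opBracket m f h' := by
  rw [nablaHom_apply, sub_eq_add_neg, ← neg_one_smul k (opBracket m f h'),
    epsHom_rmul_add he _ ((h.isDer_opBracket h2 f h').smul (-1))]
  module

/-- Applying `ε` turns the operator into minus the triple product with middle argument `f`,
symmetric in `h'` and `x`. -/
theorem IsJordanMul.epsHom_nablaHom_apply_comm (h : IsJordanMul m) (h2 : (2 : k) ≠ 0)
    (he : IsUnity m e) (f h' x : V) :
    epsHom m e (nablaHom m f h') x = epsHom m e (nablaHom m f x) h' := by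
  simp only [h.epsHom_nablaHom h2 he, LinearMap.sub_apply, LinearMap.neg_apply, rmul_apply,
    opBracket_apply]
  rw [h.comm h' x, h.comm h' (m f x), h.comm x (m f h'), h.comm x f, h.comm h' f]
  abel

/-- The linearized Jordan identity, read as an identity of operators on its fourth variable. -/
theorem IsJordanMul.opBracket_cyclic (h : IsJordanMul m) (h2 : (2 : k) ≠ 0) (x y z : V) :
    opBracket m (m x y) z + opBracket m (m y z) x + opBracket m (m z x) y = 0 := by
  ext v
  have h' := h.linearized h2 x y z v
  simp only [LinearMap.add_apply, LinearMap.zero_apply, opBracket_apply]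
  rw [h.comm (m x v), h.comm (m y v), h.comm (m z v), h.comm x (m v _), h.comm y (m v _),
    h.comm z (m v _), h.comm x v, h.comm y v, h.comm z v, h.comm x z] at h'
  rw [h.comm (m v z) (m x y), h.comm (m v x) (m y z), h.comm (m v y) (m z x)]
  linear_combination (norm := module) -h'

theorem IsJordanMul.rcomm_nablaHom (h : IsJordanMul m) (h2 : (2 : k) ≠ 0) (he : IsUnity m e)
    (f h' : V) {u : Module.End k V} (hu : IsRmulAddDer m u) :
    rcomm (nablaHom m f h') u = nablaHom m (u f) h' + nablaHom m f (epsHom m e u h') := by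
  obtain ⟨g, d, hd, rfl⟩ := hu
  rw [epsHom_rmul_add he g hd]
  simp only [nablaHom_apply, rcomm_add_right, rcomm_sub_left, LinearMap.add_apply,
    LinearMap.sub_apply, map_add, map_sub, rmul_apply, hd.rcomm_rmul h.comm,
    hd.rcomm_opBracket h.comm]
  rw [hd f h', h.comm h' (d f), map_add, rcomm_swap (opBracket m f h'),
    (h.isDer_opBracket h2 f h').rcomm_rmul h.comm]
  -- The terms in `d` match by the derivation law; the contribution of `g'` is this cyclic identity.
  have hc := h.opBracket_cyclic h2 f h' g
  have hc' : rcomm (rmul m (m f h')) (rmul m g) = opBracket m (m f h') g := rfl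
  have hs : opBracket m f (m h' g) = -opBracket m (m h' g) f := rcomm_swap _ _
  rw [hc', hs, opBracket_apply m f h' g, map_sub, h.comm f g, h.comm g h', h.comm (m h' g) f]
  linear_combination (norm := module) hc

/-- `ε` is the sign map of a grading modulo 2 in which multiplications are odd and derivations even:
`[g', g'']` and `[d, d']` are derivations, `[g', d]` is a multiplication. -/
theorem IsJordanMul.epsHom_rcomm (h : IsJordanMul m) (h2 : (2 : k) ≠ 0) (he : IsUnity m e)
    {u v : Module.End k V} (hu : IsRmulAddDer m u) (hv : IsRmulAddDer m v) :
    epsHom m e (rcomm u v) = rcomm (epsHom m e u) (epsHom m e v) := by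
  obtain ⟨g, d, hd, rfl⟩ := hu
  obtain ⟨g', d', hd', rfl⟩ := hv
  have e1 : rcomm (rmul m g + d) (rmul m g' + d') =
      rmul m (d' g - d g') + (opBracket m g g' + rcomm d d') := by
    rw [rcomm_add_left, rcomm_add_right, rcomm_add_right, rcomm_swap d (rmul m g'),
      hd.rcomm_rmul h.comm, hd'.rcomm_rmul h.comm, map_sub]
    change opBracket m g g' + _ + _ = _
    abel
  rw [e1, epsHom_rmul_add he _ ((h.isDer_opBracket h2 g g').add (hd.rcomm h.comm hd')),
    epsHom_rmul_add he g hd, epsHom_rmul_add he g' hd', rcomm_sub_left, rcomm_sub_right,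
    rcomm_sub_right, rcomm_swap d (rmul m g'), hd.rcomm_rmul h.comm, hd'.rcomm_rmul h.comm,
    map_sub]
  change _ = _ - (_ - opBracket m g g')
  abel

end Algebra

/-! ### `L(A*)` is a Lie algebra -/

section Bracket

variable {k A : Type*} [Field k] [AddCommGroup A] [Module k A] {Δ : A →ₗ[k] A ⊗[k] A}

theorem isRmulAddDer_of_mem_opSpace {u : Module.End k (Module.Dual k A)} (hu : u ∈ opSpace Δ) :
    IsRmulAddDer (dualMul Δ) u := by
  obtain ⟨_, ⟨g, rfl⟩, d, hd, rfl⟩ := Submodule.mem_sup.mp hu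
  exact ⟨g, d, hd.1, rfl⟩

theorem KKTAlg.ext {x y : KKTAlg Δ} (h1 : x.1 = y.1) (h2 : x.2.1.1 = y.2.1.1)
    (h3 : x.2.2 = y.2.2) : x = y :=
  Prod.ext h1 (Prod.ext (Subtype.ext h2) h3)

variable (hJ : IsJordanCoalgebra Δ) (h2 : (2 : k) ≠ 0) (e : Module.Dual k A)

theorem kktBracket_fst (x y : KKTAlg Δ) :
    (kktBracket hJ h2 e x y).1 = y.2.1.1 x.1 - x.2.1.1 y.1 := rfl

theorem kktBracket_op (x y : KKTAlg Δ) :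
    (kktBracket hJ h2 e x y).2.1.1 = nablaHom (dualMul Δ) x.1 y.2.2 -
      nablaHom (dualMul Δ) y.1 x.2.2 + rcomm x.2.1.1 y.2.1.1 := rfl

theorem kktBracket_bar (x y : KKTAlg Δ) :
    (kktBracket hJ h2 e x y).2.2 = epsHom (dualMul Δ) e y.2.1.1 x.2.2 -
      epsHom (dualMul Δ) e x.2.1.1 y.2.2 := rfl

/-- The product of `L(A*)` as a bilinear map. -/
noncomputable def kktBracketHom : KKTAlg Δ →ₗ[k] KKTAlg Δ →ₗ[k] KKTAlg Δ :=
  LinearMap.mk₂ k (kktBracket hJ h2 e)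
    (fun x x' y => by
      apply KKTAlg.ext <;> simp only [kktBracket_fst, kktBracket_op, kktBracket_bar,
        Prod.fst_add, Prod.snd_add, Submodule.coe_add, map_add, LinearMap.add_apply,
        rcomm_add_left] <;> abel)
    (fun c x y => by
      apply KKTAlg.ext <;> simp only [kktBracket_fst, kktBracket_op, kktBracket_bar,
        Prod.smul_fst, Prod.smul_snd, Submodule.coe_smul, map_smul, LinearMap.smul_apply,
        rcomm_smul_left, smul_sub, smul_add])
    (fun x y y' => by
      apply KKTAlg.ext <;> simp only [kktBracket_fst, kktBracket_op, kktBracket_bar,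
        Prod.fst_add, Prod.snd_add, Submodule.coe_add, map_add, LinearMap.add_apply,
        rcomm_add_right] <;> abel)
    (fun c x y => by
      apply KKTAlg.ext <;> simp only [kktBracket_fst, kktBracket_op, kktBracket_bar,
        Prod.smul_fst, Prod.smul_snd, Submodule.coe_smul, map_smul, LinearMap.smul_apply,
        rcomm_swap x.2.1.1, rcomm_smul_left, smul_sub, smul_add, smul_neg])

@[simp] theorem kktBracketHom_apply (x y : KKTAlg Δ) :
    kktBracketHom hJ h2 e x y = kktBracket hJ h2 e x y := rfl

/-- The Kantor-Koecher-Tits construction yields a Lie algebra. -/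
theorem isLieMul_kktBracketHom (he : IsUnity (dualMul Δ) e) :
    IsLieMul (kktBracketHom hJ h2 e) where
  self x := by
    have : rcomm x.2.1.1 x.2.1.1 = 0 := sub_self _
    apply KKTAlg.ext <;> simp [kktBracket_fst, kktBracket_op, kktBracket_bar, this]
  jacobi x y z := by
    have hx := isRmulAddDer_of_mem_opSpace x.2.1.2
    have hy := isRmulAddDer_of_mem_opSpace y.2.1.2
    have hz := isRmulAddDer_of_mem_opSpace z.2.1.2
    simp only [kktBracketHom_apply]
    apply KKTAlg.ext
    · simp only [kktBracket_fst, kktBracket_op, Prod.fst_add, Prod.fst_zero,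
        LinearMap.add_apply, LinearMap.sub_apply, map_sub, rcomm_apply]
      -- Flipping three of the six triple products makes them cancel against the other three.
      rw [IsJordanMul.nablaHom_apply_comm hJ x.1 y.2.2 z.1,
        IsJordanMul.nablaHom_apply_comm hJ y.1 x.2.2 z.1,
        IsJordanMul.nablaHom_apply_comm hJ y.1 z.2.2 x.1]
      abel
    · have hjac := rcomm_jacobi x.2.1.1 y.2.1.1 z.2.1.1
      simp only [kktBracket_fst, kktBracket_op, kktBracket_bar, Prod.fst_add, Prod.snd_add,
        Submodule.coe_add, Prod.fst_zero, Prod.snd_zero, Submodule.coe_zero,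
        LinearMap.sub_apply, map_sub, rcomm_add_left, rcomm_sub_left,
        IsJordanMul.rcomm_nablaHom hJ h2 he _ _ hx, IsJordanMul.rcomm_nablaHom hJ h2 he _ _ hy,
        IsJordanMul.rcomm_nablaHom hJ h2 he _ _ hz]
      linear_combination (norm := abel) hjac
    · simp only [kktBracket_op, kktBracket_bar, Prod.snd_add, Prod.snd_zero,
        LinearMap.add_apply, LinearMap.sub_apply, map_sub, map_add,
        IsJordanMul.epsHom_rcomm hJ h2 he hx hy, IsJordanMul.epsHom_rcomm hJ h2 he hy hz,
        IsJordanMul.epsHom_rcomm hJ h2 he hz hx, rcomm_apply]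
      rw [IsJordanMul.epsHom_nablaHom_apply_comm hJ h2 he x.1 y.2.2 z.2.2,
        IsJordanMul.epsHom_nablaHom_apply_comm hJ h2 he y.1 x.2.2 z.2.2,
        IsJordanMul.epsHom_nablaHom_apply_comm hJ h2 he z.1 x.2.2 y.2.2]
      abel

end Bracket

/-! ### The subspaces `L_B` cover `L(A)` and have ideals as annihilators -/

section Pieces

variable {k A : Type*} [Field k] [AddCommGroup A] [Module k A] {Δ : A →ₗ[k] A ⊗[k] A}

theorem exists_mem_coOpPiece (hJ : IsJordanCoalgebra Δ) (h2 : (2 : k) ≠ 0)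
    {w : Module.End k (Module.Dual k A × A)} (hw : w ∈ coOpSpace Δ) :
    ∃ B : Submodule k A, FiniteDimensional k B ∧ IsSubcoalgebra Δ B ∧ w ∈ coOpPiece Δ B := by
  rw [← range_coOpMap] at hw
  obtain ⟨⟨b, t⟩, rfl⟩ := hw
  have ht : ∃ B : Submodule k A, FiniteDimensional k B ∧ IsSubcoalgebra Δ B ∧
      TensorProduct.lift (mixedHom Δ) t ∈ coOpPiece Δ B := by
    induction t with
    | zero =>
      obtain ⟨B, hB, hs, -⟩ := hJ.exists_subcoalgebra h2 0
      exact ⟨B, hB, hs, by simp⟩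
    | tmul p q =>
      obtain ⟨B, hB, hs, hq⟩ := hJ.exists_subcoalgebra h2 q
      exact ⟨B, hB, hs, mixed_mem_coOpPiece p hq⟩
    | add x y hx hy =>
      obtain ⟨B, hB, hs, h⟩ := hx
      obtain ⟨B', hB', hs', h'⟩ := hy
      refine ⟨B ⊔ B', inferInstance, hs.sup hs', ?_⟩
      rw [map_add]
      exact add_mem (coOpPiece_mono le_sup_left h) (coOpPiece_mono le_sup_right h')
  obtain ⟨B, hB, hs, h⟩ := ht
  obtain ⟨B', hB', hs', hb⟩ := hJ.exists_subcoalgebra h2 b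
  exact ⟨B ⊔ B', inferInstance, hs.sup hs', add_mem
    (coOpPiece_mono le_sup_right (prime_mem_coOpPiece hb)) (coOpPiece_mono le_sup_left h)⟩

theorem mem_piece {B : Submodule k A} {l : KKTCoalg Δ} :
    l ∈ piece Δ B ↔ l.1 ∈ B ∧ l.2.1.1 ∈ coOpPiece Δ B ∧ l.2.2 ∈ B := Iff.rfl

theorem exists_mem_piece (hJ : IsJordanCoalgebra Δ) (h2 : (2 : k) ≠ 0) (l : KKTCoalg Δ) :
    ∃ B : Submodule k A, FiniteDimensional k B ∧ IsSubcoalgebra Δ B ∧ l ∈ piece Δ B := by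
  obtain ⟨B, hB, hs, h⟩ := hJ.exists_subcoalgebra h2 l.1
  obtain ⟨B', hB', hs', h'⟩ := exists_mem_coOpPiece hJ h2 l.2.1.2
  obtain ⟨B'', hB'', hs'', h''⟩ := hJ.exists_subcoalgebra h2 l.2.2
  exact ⟨B ⊔ B' ⊔ B'', inferInstance, (hs.sup hs').sup hs'', mem_piece.mpr
    ⟨Submodule.mem_sup_left (Submodule.mem_sup_left h),
      coOpPiece_mono (le_sup_right.trans le_sup_left) h', Submodule.mem_sup_right h''⟩⟩

/-- `x` lies in the ideal of `L(A*)` of the elements that vanish on `L_B`. -/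
def VanishesOn (B : Submodule k A) (x : KKTAlg Δ) : Prop :=
  (∀ b ∈ B, x.1 b = 0) ∧ (∀ p : Module.Dual k A, ∀ b ∈ B, x.2.1.1 p b = 0) ∧
    ∀ b ∈ B, x.2.2 b = 0

theorem wIntDer_apply_eq_zero {B : Submodule k A} [hB : FiniteDimensional k B]
    (hs : IsSubcoalgebra Δ B) {d : Module.End k (Module.Dual k A)} (hd : d ∈ wIntDer Δ)
    {f : Module.Dual k A} (hf : ∀ b ∈ B, f b = 0) : ∀ b ∈ B, d f b = 0 := by
  intro b hb
  obtain ⟨i, hi, h⟩ := hd.2 B hB hs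
  rw [h f b hb, hs.intDer_apply_eq_zero hi hf b hb]

theorem opSpace_apply_eq_zero {B : Submodule k A} [FiniteDimensional k B]
    (hs : IsSubcoalgebra Δ B) {u : Module.End k (Module.Dual k A)} (hu : u ∈ opSpace Δ)
    {f : Module.Dual k A} (hf : ∀ b ∈ B, f b = 0) : ∀ b ∈ B, u f b = 0 := by
  obtain ⟨_, ⟨g, rfl⟩, d, hd, rfl⟩ := Submodule.mem_sup.mp hu
  intro b hb
  rw [LinearMap.add_apply, LinearMap.add_apply, rmul_apply, hs.dualMul_eq_zero (.inl hf) b hb,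
    wIntDer_apply_eq_zero hs hd hf b hb, add_zero]

theorem nablaHom_apply_eq_zero {B : Submodule k A} (hs : IsSubcoalgebra Δ B)
    {f h : Module.Dual k A} (hfh : (∀ b ∈ B, f b = 0) ∨ (∀ b ∈ B, h b = 0))
    (p : Module.Dual k A) : ∀ b ∈ B, nablaHom (dualMul Δ) f h p b = 0 := by
  intro b hb
  have h1 : dualMul Δ p (dualMul Δ f h) b = 0 :=
    hs.dualMul_eq_zero (.inr (hs.dualMul_eq_zero hfh)) b hb
  have h2 : dualMul Δ (dualMul Δ p f) h b = 0 := hs.dualMul_eq_zero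
    (hfh.imp (fun hf => hs.dualMul_eq_zero (.inr hf)) id) b hb
  have h3 : dualMul Δ (dualMul Δ p h) f b = 0 := hs.dualMul_eq_zero
    (hfh.symm.imp (fun hf => hs.dualMul_eq_zero (.inr hf)) id) b hb
  simp only [nablaHom_apply, LinearMap.sub_apply, rmul_apply, opBracket_apply, h1, h2, h3,
    sub_zero]

/-- Operators of `R(A*)` preserve the annihilator of `B`, and products with a factor in it stay in
it. One-sided absorption suffices, as the bracket is skew. -/
theorem vanishesOn_kktBracket (hJ : IsJordanCoalgebra Δ) (h2 : (2 : k) ≠ 0)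
    (e : Module.Dual k A) {B : Submodule k A} [FiniteDimensional k B]
    (hs : IsSubcoalgebra Δ B) {x y : KKTAlg Δ} (hx : VanishesOn B x) :
    VanishesOn B (kktBracket hJ h2 e x y) := by
  obtain ⟨h1, hu, h3⟩ := hx
  refine ⟨fun b hb => ?_, fun p b hb => ?_, fun b hb => ?_⟩
  · rw [kktBracket_fst, LinearMap.sub_apply, opSpace_apply_eq_zero hs y.2.1.2 h1 b hb,
      hu _ b hb, sub_zero]
  · simp only [kktBracket_op, LinearMap.add_apply, LinearMap.sub_apply, rcomm_apply]
    rw [nablaHom_apply_eq_zero hs (.inl h1) p b hb, nablaHom_apply_eq_zero hs (.inr h3) p b hb,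
      hu _ b hb, opSpace_apply_eq_zero hs y.2.1.2 (hu p) b hb]
    simp
  · simp only [kktBracket_bar, epsHom_apply, LinearMap.sub_apply, LinearMap.smul_apply,
      rmul_apply]
    rw [opSpace_apply_eq_zero hs y.2.1.2 h3 b hb, hu _ b hb,
      hs.dualMul_eq_zero (.inl h3) b hb, hs.dualMul_eq_zero (.inr (hu e)) b hb]
    simp

variable {e : Module.Dual k A} {Φ : KKTAlg Δ ≃ₗ[k] Module.Dual k (KKTCoalg Δ)}

/-- Pairing with `b'` shows that `eu` vanishes on `B`; then `(eu)'` contributes nothing on `B`, so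
vanishing of the derivation part gives vanishing of `u` itself. -/
theorem vanishesOn_of_pairing
    (hΦ : ∀ (x : KKTAlg Δ) (l : KKTCoalg Δ) (z : A × (Module.Dual k A ⊗[k] A)),
      l.2.1.1 = coOpMap Δ z → Φ x l = x.1 l.1 + prePairing Δ e x.2.1.1 z + x.2.2 l.2.2)
    {B : Submodule k A} (hs : IsSubcoalgebra Δ B) {x : KKTAlg Δ}
    (hx : ∀ l ∈ piece Δ B, Φ x l = 0) : VanishesOn B x := by
  refine ⟨fun b hb => ?_, fun p b hb => ?_, fun b hb => ?_⟩
  · have h := hx (b, 0, 0) (mem_piece.mpr ⟨hb, zero_mem _, zero_mem _⟩)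
    rw [hΦ _ _ 0 (by simp)] at h
    simpa using h
  · have h1 : ∀ b ∈ B, x.2.1.1 e b = 0 := by
      intro b hb
      have h := hx (0, ⟨prime Δ b, prime_mem_coOpPiece trivial⟩, 0)
        (mem_piece.mpr ⟨zero_mem _, prime_mem_coOpPiece hb, zero_mem _⟩)
      rw [hΦ _ _ (b, 0) (by simp [coOpMap_apply]), prePairing_apply] at h
      simpa using h
    have h := hx (0, ⟨mixed Δ p b, mixed_mem_coOpPiece p trivial⟩, 0)
      (mem_piece.mpr ⟨zero_mem _, mixed_mem_coOpPiece p hb, zero_mem _⟩)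
    rw [hΦ _ _ (0, p ⊗ₜ b) (by simp [coOpMap_apply]), prePairing_apply] at h
    simp only [map_zero, zero_add, add_zero, endPairing_tmul, derPart_apply,
      LinearMap.sub_apply, rmul_apply] at h
    rwa [hs.dualMul_eq_zero (.inr h1) b hb, sub_zero] at h
  · have h := hx (0, 0, b) (mem_piece.mpr ⟨zero_mem _, zero_mem _, hb⟩)
    rw [hΦ _ _ 0 (by simp)] at h
    simpa using h

theorem VanishesOn.pairing_eq_zero
    (hΦ : ∀ (x : KKTAlg Δ) (l : KKTCoalg Δ) (z : A × (Module.Dual k A ⊗[k] A)),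
      l.2.1.1 = coOpMap Δ z → Φ x l = x.1 l.1 + prePairing Δ e x.2.1.1 z + x.2.2 l.2.2)
    {B : Submodule k A} (hs : IsSubcoalgebra Δ B) {x : KKTAlg Δ} (hx : VanishesOn B x)
    {l : KKTCoalg Δ} (hl : l ∈ piece Δ B) : Φ x l = 0 := by
  obtain ⟨h1, hu, h3⟩ := hx
  obtain ⟨hl1, hlw, hl3⟩ := mem_piece.mp hl
  rw [coOpPiece_eq] at hlw
  obtain ⟨_, ⟨b, hb, rfl⟩, w, hw, hbw⟩ := Submodule.mem_sup.mp hlw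
  -- The pairing may be computed from any representing tensor; one built from elements of `B` lies
  -- in the kernel of the functional.
  have hz : Submodule.map₂ (mixedHom Δ) ⊤ B ≤
      (LinearMap.ker (endPairing k A (derPart (dualMul Δ) e x.2.1.1))).map
        (TensorProduct.lift (mixedHom Δ)) := by
    refine Submodule.map₂_le.mpr fun p _ q hq => ⟨p ⊗ₜ q, ?_, by simp⟩
    simp only [SetLike.mem_coe, LinearMap.mem_ker, endPairing_tmul, derPart_apply,
      LinearMap.sub_apply, rmul_apply]
    rw [hu p q hq, hs.dualMul_eq_zero (.inr (hu e)) q hq, sub_zero]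
  obtain ⟨t, ht, rfl⟩ := hz hw
  rw [hΦ x l (b, t) hbw.symm, prePairing_apply, h1 _ hl1, h3 _ hl3, hu e b hb,
    LinearMap.mem_ker.mp ht]
  simp

end Pieces

/-! ### From local tensors to a comultiplication -/

section Comultiplication

variable {k L V : Type*} [Field k] [AddCommGroup L] [Module k L] [AddCommGroup V] [Module k V]

/-- A Lie algebra structure on the dual of `L` comes from a comultiplication on `L` if `L` is
covered by finite-dimensional subspaces whose annihilators are ideals. -/
theorem exists_comultiplication (Φ : V ≃ₗ[k] Module.Dual k L) (br : V →ₗ[k] V →ₗ[k] V)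
    (hlie : IsLieMul br) (Q : Submodule k L → Prop)
    (hfd : ∀ P, Q P → FiniteDimensional k P) (hcover : ∀ l, ∃ P, Q P ∧ l ∈ P)
    (hideal : ∀ P, Q P → ∀ x y, (∀ l ∈ P, Φ x l = 0) → ∀ l ∈ P, Φ (br x y) l = 0) :
    ∃ ΔL : L →ₗ[k] L ⊗[k] L, IsLieCoalgebra ΔL ∧
      (∀ x y, Φ (br x y) = dualMul ΔL (Φ x) (Φ y)) ∧
      ∀ P, Q P → ∃ ΔP : P →ₗ[k] P ⊗[k] P,
        (∀ (x y : V) (l : P), Φ (br x y) l = TensorProduct.dualDistrib k L L (Φ x ⊗ₜ[k] Φ y)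
          (TensorProduct.mapIncl P P (ΔP l))) ∧
        (∀ D : P →ₗ[k] L ⊗[k] L,
          (∀ (x y : V) (l : P),
            Φ (br x y) l = TensorProduct.dualDistrib k L L (Φ x ⊗ₜ[k] Φ y) (D l)) →
          D = TensorProduct.mapIncl P P ∘ₗ ΔP) ∧
        ∀ l : P, ΔL l = TensorProduct.mapIncl P P (ΔP l) := by
  have hskew : ∀ x y, br x y = -br y x := by
    intro x y
    have := hlie.self (x + y)
    rw [map_add, map_add, LinearMap.add_apply, LinearMap.add_apply, hlie.self, hlie.self,
      zero_add, add_zero] at this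
    linear_combination (norm := module) this
  have hlocal : ∀ P, Q P → ∀ l ∈ P, ∃ t : P ⊗[k] P, ∀ x y : V,
      TensorProduct.dualDistrib k L L (Φ x ⊗ₜ[k] Φ y) (TensorProduct.mapIncl P P t) =
        Φ (br x y) l := by
    intro P hP l hl
    have := hfd P hP
    have hleft : ∀ f g : Module.Dual k L, (∀ l ∈ P, f l = 0) →
        Φ (br (Φ.symm f) (Φ.symm g)) l = 0 := fun f g hf =>
      hideal P hP _ _ (fun l hl => by rw [Φ.apply_symm_apply, hf l hl]) l hl
    obtain ⟨t, ht⟩ := exists_tensor_of_bilinear P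
      ((br.compl₁₂ Φ.symm.toLinearMap Φ.symm.toLinearMap).compr₂
        (LinearMap.applyₗ l ∘ₗ Φ.toLinearMap)) hleft (fun f g hg => by
        change Φ (br (Φ.symm f) (Φ.symm g)) l = 0
        rw [hskew, map_neg, LinearMap.neg_apply, hleft g f hg, neg_zero])
    refine ⟨t, fun x y => ?_⟩
    rw [ht]
    change Φ (br (Φ.symm (Φ x)) (Φ.symm (Φ y))) l = _
    rw [Φ.symm_apply_apply, Φ.symm_apply_apply]
  let ι : L ⊗[k] L →ₗ[k] Module.Dual k (V ⊗[k] V) :=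
    (TensorProduct.dualDistrib k L L ∘ₗ
      TensorProduct.map Φ.toLinearMap Φ.toLinearMap).flip
  have hι : ∀ t x y, ι t (x ⊗ₜ y) = TensorProduct.dualDistrib k L L (Φ x ⊗ₜ Φ y) t :=
    fun _ _ _ => rfl
  have hιinj : Function.Injective ι := by
    intro s t hst
    refine eq_of_dualDistrib_eq fun f g => ?_
    have := LinearMap.congr_fun hst (Φ.symm f ⊗ₜ Φ.symm g)
    rwa [hι, hι, Φ.apply_symm_apply, Φ.apply_symm_apply] at this
  let T : L →ₗ[k] Module.Dual k (V ⊗[k] V) := (Φ.toLinearMap ∘ₗ TensorProduct.lift br).flip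
  have hT : ∀ l x y, T l (x ⊗ₜ y) = Φ (br x y) l := fun _ _ _ => rfl
  -- Pointwise existence is enough: injectivity of `ι` makes the chosen tensors depend linearly on
  -- `l` and agree between pieces.
  obtain ⟨ΔL, hΔL⟩ := exists_factorization ι hιinj T fun l => by
    obtain ⟨P, hP, hl⟩ := hcover l
    obtain ⟨t, ht⟩ := hlocal P hP l hl
    exact ⟨_, TensorProduct.ext' ht⟩
  have hmul : ∀ x y, Φ (br x y) = dualMul ΔL (Φ x) (Φ y) := by
    intro x y
    refine LinearMap.ext fun l => ?_
    rw [dualMul_apply, ← hι, hΔL, hT]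
  have hmul' : ∀ f g, dualMul ΔL f g = Φ (br (Φ.symm f) (Φ.symm g)) := by
    intro f g
    rw [hmul, Φ.apply_symm_apply, Φ.apply_symm_apply]
  refine ⟨ΔL, ⟨fun f => ?_, fun f g h => ?_⟩, hmul, fun P hP => ?_⟩
  · rw [hmul', hlie.self, map_zero]
  · simp only [hmul', Φ.symm_apply_apply]
    rw [← map_add, ← map_add, hlie.jacobi, map_zero]
  · have hinj : Function.Injective (ι ∘ₗ TensorProduct.mapIncl P P) :=
      hιinj.comp (mapIncl_injective _)
    obtain ⟨ΔP, hΔP⟩ := exists_factorization _ hinj (T ∘ₗ P.subtype) fun l => by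
      obtain ⟨t, ht⟩ := hlocal P hP l.1 l.2
      exact ⟨t, TensorProduct.ext' ht⟩
    refine ⟨ΔP, fun x y l => (LinearMap.congr_fun (hΔP l) (x ⊗ₜ y)).symm, fun D hD => ?_,
      fun l => hιinj ((hΔL l).trans (hΔP l).symm)⟩
    refine LinearMap.ext fun l => hιinj (TensorProduct.ext' fun x y => ?_)
    rw [LinearMap.comp_apply, hι, ← hD]
    exact (LinearMap.congr_fun (hΔP l) (x ⊗ₜ y)).symm

end Comultiplication

end KKT

theorem theorem1 {k A : Type*} [Field k] [AddCommGroup A] [Module k A]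
    (Δ : A →ₗ[k] A ⊗[k] A) (h2 : (2 : k) ≠ 0) (hJ : KKT.IsJordanCoalgebra Δ)
    (e : Module.Dual k A) (he : KKT.IsUnity (KKT.dualMul Δ) e) :
    ∃ (ΔL : KKT.KKTCoalg Δ →ₗ[k] KKT.KKTCoalg Δ ⊗[k] KKT.KKTCoalg Δ)
      (Φ : KKT.KKTAlg Δ ≃ₗ[k] Module.Dual k (KKT.KKTCoalg Δ)),
      -- the comultiplication makes `L(A)` a Lie coalgebra
      KKT.IsLieCoalgebra ΔL ∧
      -- the canonical pairing identifies `L(A*)` with the dual algebra of `L(A)`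
      KKT.IsCanonicalPairing Δ Φ.toLinearMap ∧
      (∀ x y : KKT.KKTAlg Δ,
        Φ (KKT.kktBracket hJ h2 e x y) = KKT.dualMul ΔL (Φ x) (Φ y)) ∧
      -- the finite-dimensional pieces exhaust `L(A)`
      (∀ l : KKT.KKTCoalg Δ, ∃ B : Submodule k A, FiniteDimensional k B ∧
        KKT.IsSubcoalgebra Δ B ∧ l ∈ KKT.piece Δ B) ∧
      -- on each piece the comultiplication restricts to the one determined there by the pairing
      (∀ B : Submodule k A, FiniteDimensional k B → KKT.IsSubcoalgebra Δ B →
        FiniteDimensional k (KKT.piece Δ B) ∧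
        ∃ ΔB : KKT.piece Δ B →ₗ[k] KKT.piece Δ B ⊗[k] KKT.piece Δ B,
          (∀ (x y : KKT.KKTAlg Δ) (l : KKT.piece Δ B),
            Φ (KKT.kktBracket hJ h2 e x y) l =
              TensorProduct.dualDistrib k (KKT.KKTCoalg Δ) (KKT.KKTCoalg Δ) (Φ x ⊗ₜ[k] Φ y)
                (TensorProduct.mapIncl (KKT.piece Δ B) (KKT.piece Δ B) (ΔB l))) ∧
          (∀ D : KKT.piece Δ B →ₗ[k] KKT.KKTCoalg Δ ⊗[k] KKT.KKTCoalg Δ,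
            (∀ (x y : KKT.KKTAlg Δ) (l : KKT.piece Δ B),
              Φ (KKT.kktBracket hJ h2 e x y) l =
                TensorProduct.dualDistrib k (KKT.KKTCoalg Δ) (KKT.KKTCoalg Δ)
                  (Φ x ⊗ₜ[k] Φ y) (D l)) →
            D = TensorProduct.mapIncl (KKT.piece Δ B) (KKT.piece Δ B) ∘ₗ ΔB) ∧
          ∀ l : KKT.piece Δ B,
            ΔL l = TensorProduct.mapIncl (KKT.piece Δ B) (KKT.piece Δ B) (ΔB l)) := by
  refine Exists.elim (KKT.exists_pairing hJ h2 he) fun Φ hΦ => ?_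
  have hlie := KKT.isLieMul_kktBracketHom hJ h2 e he
  let Q : Submodule k (KKT.KKTCoalg Δ) → Prop := fun P =>
    ∃ B : Submodule k A, FiniteDimensional k B ∧ KKT.IsSubcoalgebra Δ B ∧ P = KKT.piece Δ B
  have hfd : ∀ P, Q P → FiniteDimensional k P := by
    rintro P ⟨B, hB, hs, rfl⟩
    exact KKT.finiteDimensional_piece hJ hs
  have hcover : ∀ l, ∃ P, Q P ∧ l ∈ P := by
    intro l
    obtain ⟨B, hB, hs, hl⟩ := KKT.exists_mem_piece hJ h2 l
    exact ⟨_, ⟨B, hB, hs, rfl⟩, hl⟩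
  have hideal : ∀ P, Q P → ∀ x y, (∀ l ∈ P, Φ x l = 0) →
      ∀ l ∈ P, Φ (KKT.kktBracketHom hJ h2 e x y) l = 0 := by
    rintro P ⟨B, hB, hs, rfl⟩ x y hx l hl
    exact (KKT.vanishesOn_kktBracket hJ h2 e hs
      (KKT.vanishesOn_of_pairing hΦ hs hx)).pairing_eq_zero hΦ hs hl
  have key := KKT.exists_comultiplication Φ _ hlie Q hfd hcover hideal
  refine Exists.elim key fun ΔL h => ?_
  exact ⟨ΔL, Φ, h.1, KKT.isCanonicalPairing_of_prePairing he hΦ, h.2.1,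
    KKT.exists_mem_piece hJ h2, fun B hB hs =>
      ⟨KKT.finiteDimensional_piece hJ hs, h.2.2 _ ⟨B, hB, hs, rfl⟩⟩⟩
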